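/- Let $d\ge 1$, let $T,\Omega\subset\mathbb R^d$ be Lebesgue measurable sets of finite measure, and let $0<\varepsilon<1$. Work in $L^2(\mathbb R^d)$ (complex-valued functions), with the Fourier transform $Ff(\xi)=(2\pi)^{-d/2}\int f(t)e^{-i\xi\cdot t}\,dt$. For a set $A\subset\mathbb R^d$ let $D_A$ be the orthogonal projection onto $\{f: f=0 \text{ a.e. outside } A\}$ and $B_\Omega$ the orthogonal projection onto $\{f: Ff=0\text{ a.e. outside }\Omega\}$. For $r>0$ put $P_r=P_{rT,\Omega}=D_{rT}B_\Omega D_{rT}$, and let $\eta(\varepsilon,rT,\Omega)$ be the maximal number of orthonormal functions $f$ with $\|P_rf-f\|^2\le\varepsilon$. For $N\in\mathbb N$ let $X'_N$ be the real $N\times N$ matrix with entries $\operatorname{Re}X_{ij}+\operatorname{Im}X_{ij}$, where $X_{ij}=N^{-1/2}e^{-2\pi i\,\cdot\, ij/N}$ $(0\le i,j\le N-1)$ is the DFT matrix (in the exponent the first $i$ is the imaginary unit). For $r>0$ and $\sigma>0$ with $\sigma^2\le\varepsilon$, let $\phi_1,\dots,\phi_n$ be an orthonormal system of eigenfunctions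 of $P_r$ for all its eigenvalues $>1-\sigma$, counted with multiplicity, and let $h_1,\dots,h_m$ be orthonormal vectors in $\ker P_r$. Let $Q$ be obtained from $X'_{m+n}$ by a permutation of its columns such that the last $m$ columns of $Q$ are the columns $1,\dots,\lfloor m/2\rfloor$ and the last $\lfloor m/2\rfloor$ columns of $X'_{m+n}$, together with the column $0$ if $m$ is odd. Put $$\Phi_j=\psi_j+\rho_j,\qquad \psi_j=\sum_{k=1}^nQ_{jk}\phi_k,\qquad \rho_j=\sum_{k=1}^mQ_{j,n+k}h_k\qquad(1\le j\le m+n).$$ Let $\gamma(\sigma)=(\varepsilon-\sigma^2)/(1-\sigma^2)$. Then: 1. $X'_N$ is orthogonal for every $N$. 2. For all $r>0$ and $\sigma>0$ with $\sigma^2\le\varepsilon$, the number $n$ is finite, and if $n\ge1$ or $m=0$, such $\phi_k$, $h_k$ and $Q$ exist. 3. For every such choice, $(\Phi_j)$ is an orthonormal basis of $\operatorname{span}\{\phi_k\}\oplus\operatorname{span}\{h_k\}$, and for every $j$ one has $\rho_j\in\ker P_r$, $\psi_j\perp\ker P_r$, $$\|\rho_j\|^2=\frac m{m+n},\qquad \|P_r\Phi_j-\Phi_j\|^2\le\sigma^2+(1-\sigma^2)\frac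 m{m+n}.$$ 4. For fixed $\sigma>0$ with $\sigma^2\le\varepsilon$, take $m=\lfloor n\gamma(\sigma)/(1-\gamma(\sigma))\rfloor$. The construction can then be carried out for every $r>0$, all $\Phi_j$ satisfy $\|P_r\Phi_j-\Phi_j\|^2\le\varepsilon$, and as $r\to\infty$ their number satisfies $$m+n\ \ge\ (1-\gamma(\sigma))^{-1}(2\pi)^{-d}|T||\Omega|\,r^d+o(r^d).$$ 5. With suitable $\sigma=\sigma(r)>0$, $\sigma(r)^2\le\varepsilon$, and suitable $m=m(r)$, the construction yields for every $r>0$ orthonormal functions $\Phi_j$ with $\|P_r\Phi_j-\Phi_j\|^2\le\varepsilon$ whose number is, as $r\to\infty$, at least $$(1-\varepsilon)^{-1}(2\pi)^{-d}|T||\Omega|\,r^d+o(r^d).$$ 6. $\eta(\varepsilon,rT,\Omega)$ is finite for every $r>0$, and $$\liminf_{r\to\infty}\frac{\eta(\varepsilon,rT,\Omega)}{r^d}\ \ge\ (1-\varepsilon)^{-1}\frac{|T||\Omega|}{(2\pi)^d}.$$ -/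

import Mathlib

open MeasureTheory Filter Topology Asymptotics
open scoped FourierTransform Pointwise ENNReal Matrix

noncomputable section

namespace PseudoProlate

/-! ### Time- and band-limiting operators on `L²(ℝᵈ; ℂ)` -/

/-- The Hilbert space `L²(ℝᵈ)` of complex-valued functions. -/
abbrev L2 (d : ℕ) : Type := Lp (α := EuclideanSpace ℝ (Fin d)) ℂ 2 volume

/-- Vanishing almost everywhere outside a set (after a change of variables `θ`) is a closed
condition in `L²`. -/
theorem isClosed_vanishing {d : ℕ} (S : Set (EuclideanSpace ℝ (Fin d)))
    (θ : EuclideanSpace ℝ (Fin d) → EuclideanSpace ℝ (Fin d))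
    (hθ : Measure.QuasiMeasurePreserving θ volume volume) :
    IsClosed {f : L2 d | ∀ᵐ x, x ∉ S → f (θ x) = 0} := by
  refine IsSeqClosed.isClosed ?_
  intro u f hu hf
  obtain ⟨ns, -, hns⟩ := (tendstoInMeasure_of_tendsto_Lp hf).exists_seq_tendsto_ae
  have h1 := hθ.ae hns
  have h2 : ∀ᵐ x, ∀ n, x ∉ S → u n (θ x) = 0 := ae_all_iff.2 hu
  filter_upwards [h1, h2] with x hx1 hx2 hxS
  refine tendsto_nhds_unique hx1 ?_
  simp [hx2 _ hxS]

/-- `𝒟(T)`: the functions in `L²(ℝᵈ)` that vanish (almost everywhere) outside `T`. -/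
def timeLimited {d : ℕ} (T : Set (EuclideanSpace ℝ (Fin d))) : Submodule ℂ (L2 d) where
  carrier := {f | ∀ᵐ x, x ∉ T → f x = 0}
  add_mem' := by
    intro f g hf hg
    filter_upwards [hf, hg, Lp.coeFn_add f g] with x h1 h2 h3 hx
    rw [h3, Pi.add_apply, h1 hx, h2 hx, add_zero]
  zero_mem' := by
    filter_upwards [Lp.coeFn_zero ℂ 2 (volume : Measure (EuclideanSpace ℝ (Fin d)))] with x h _
    rw [h, Pi.zero_apply]
  smul_mem' := by
    intro c f hf
    filter_upwards [hf, Lp.coeFn_smul c f] with x h1 h2 hx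
    rw [h2, Pi.smul_apply, h1 hx, smul_zero]

/-- The change of variables `ξ ↦ ξ / (2π)` preserves null sets. -/
theorem quasiMeasurePreserving_scale (d : ℕ) :
    Measure.QuasiMeasurePreserving
      (fun ξ : EuclideanSpace ℝ (Fin d) => (2 * Real.pi)⁻¹ • ξ) volume volume := by
  have hc : (2 * Real.pi)⁻¹ ≠ 0 := inv_ne_zero (by positivity)
  refine ⟨measurable_const_smul _, ?_⟩
  rw [Measure.map_addHaar_smul _ hc]
  exact Measure.smul_absolutelyContinuous

/-- The (Plancherel) Fourier transform on `L²(ℝᵈ)` in the normalization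
`F f (ξ) = (2π)^(-d/2) ∫ f(t) exp(-i ξ·t) dt`. Mathlib's transform is
`𝓕 f (ξ) = ∫ f(t) exp(-2πi ξ·t) dt`, so that `F f (ξ) = (2π)^(-d/2) 𝓕 f (ξ / (2π))`. -/
def angularFourier {d : ℕ} (f : L2 d) (ξ : EuclideanSpace ℝ (Fin d)) : ℂ :=
  (((2 * Real.pi) ^ (-(d : ℝ) / 2) : ℝ) : ℂ) * (𝓕 f : L2 d) ((2 * Real.pi)⁻¹ • ξ)

theorem angularFourier_eq_zero_iff {d : ℕ} (f : L2 d) (ξ : EuclideanSpace ℝ (Fin d)) :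
    angularFourier f ξ = 0 ↔ (𝓕 f : L2 d) ((2 * Real.pi)⁻¹ • ξ) = 0 := by
  have h : ((2 * Real.pi) ^ (-(d : ℝ) / 2) : ℝ) ≠ 0 := by positivity
  simp only [angularFourier, mul_eq_zero, Complex.ofReal_eq_zero, h, false_or]

/-- `ℬ(Ω)`: the functions in `L²(ℝᵈ)` whose Fourier transform vanishes (almost everywhere)
outside `Ω`. -/
def bandLimited {d : ℕ} (Ω : Set (EuclideanSpace ℝ (Fin d))) : Submodule ℂ (L2 d) where
  carrier := {f | ∀ᵐ ξ, ξ ∉ Ω → angularFourier f ξ = 0}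
  add_mem' := by
    intro f g hf hg
    have h3 := (quasiMeasurePreserving_scale d).ae (Lp.coeFn_add (𝓕 f : L2 d) (𝓕 g))
    filter_upwards [hf, hg, h3] with x h1 h2 h3 hx
    have h1 := (angularFourier_eq_zero_iff f x).1 (h1 hx)
    have h2 := (angularFourier_eq_zero_iff g x).1 (h2 hx)
    rw [angularFourier_eq_zero_iff, FourierTransform.fourier_add, h3, Pi.add_apply, h1, h2, add_zero]
  zero_mem' := by
    have h3 := (quasiMeasurePreserving_scale d).ae
      (Lp.coeFn_zero ℂ 2 (volume : Measure (EuclideanSpace ℝ (Fin d))))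
    have h0 : (𝓕 (0 : L2 d) : L2 d) = 0 := (Lp.fourierTransformₗᵢ _ ℂ).map_zero
    filter_upwards [h3] with x h _
    rw [angularFourier_eq_zero_iff, h0, h, Pi.zero_apply]
  smul_mem' := by
    intro c f hf
    have h3 := (quasiMeasurePreserving_scale d).ae (Lp.coeFn_smul c (𝓕 f : L2 d))
    filter_upwards [hf, h3] with x h1 h3 hx
    have h1 := (angularFourier_eq_zero_iff f x).1 (h1 hx)
    rw [angularFourier_eq_zero_iff, FourierTransform.fourier_smul, h3, Pi.smul_apply, h1, smul_zero]

instance completeSpace_timeLimited {d : ℕ} (T : Set (EuclideanSpace ℝ (Fin d))) :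
    CompleteSpace (timeLimited T) :=
  (isClosed_vanishing T id (Measure.QuasiMeasurePreserving.id volume)).completeSpace_coe

instance completeSpace_bandLimited {d : ℕ} (Ω : Set (EuclideanSpace ℝ (Fin d))) :
    CompleteSpace (bandLimited Ω) := by
  have h : IsClosed {f : L2 d | ∀ᵐ ξ, ξ ∉ Ω → angularFourier f ξ = 0} := by
    simp only [angularFourier_eq_zero_iff]
    exact (isClosed_vanishing Ω _ (quasiMeasurePreserving_scale d)).preimage
      (Lp.fourierTransformₗᵢ (EuclideanSpace ℝ (Fin d)) ℂ).continuous
  exact h.completeSpace_coe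

/-- `D_T`: the orthogonal projection of `L²(ℝᵈ)` onto `𝒟(T)`. -/
def timeProj {d : ℕ} (T : Set (EuclideanSpace ℝ (Fin d))) : L2 d →L[ℂ] L2 d :=
  (timeLimited T).starProjection

/-- `B_Ω`: the orthogonal projection of `L²(ℝᵈ)` onto `ℬ(Ω)`. -/
def bandProj {d : ℕ} (Ω : Set (EuclideanSpace ℝ (Fin d))) : L2 d →L[ℂ] L2 d :=
  (bandLimited Ω).starProjection

/-- The time- and band-limiting operator `P_{T,Ω} = D_T B_Ω D_T`. -/
def limitingOp {d : ℕ} (T Ω : Set (EuclideanSpace ℝ (Fin d))) : L2 d →L[ℂ] L2 d :=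
  timeProj T ∘L bandProj Ω ∘L timeProj T

/-- `η(ε,T,Ω)`: the maximal number of orthonormal functions `f` with
`‖P_{T,Ω} f - f‖² ≤ ε` (a supremum in `ℕ∞`). -/
def maxCount {d : ℕ} (ε : ℝ) (T Ω : Set (EuclideanSpace ℝ (Fin d))) : ℕ∞ :=
  sSup {c : ℕ∞ | ∃ N : ℕ, c = N ∧ ∃ Φ : Fin N → L2 d, Orthonormal ℂ Φ ∧
    ∀ j, ‖limitingOp T Ω (Φ j) - Φ j‖ ^ 2 ≤ ε}

/-! ### The real form of the discrete Fourier transform matrix -/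

/-- The unitary DFT matrix of order `N`: entries `ω^(ij) / √N`, `ω = exp(-2πi/N)`,
`i, j = 0, …, N - 1`. -/
def dftMatrix (N : ℕ) : Matrix (Fin N) (Fin N) ℂ :=
  Matrix.of fun i j =>
    ((Real.sqrt N : ℝ) : ℂ)⁻¹ * Complex.exp (-(2 * Real.pi * Complex.I) / N) ^ ((i : ℕ) * (j : ℕ))

/-- The real matrix whose entries are `Re + Im` of the entries of the DFT matrix. -/
def realDFT (N : ℕ) : Matrix (Fin N) (Fin N) ℝ :=
  Matrix.of fun i j => (dftMatrix N i j).re + (dftMatrix N i j).im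

/-- The columns of `realDFT N` that are used for the `m` kernel vectors: the columns
`1, …, ⌊m/2⌋`, the last `⌊m/2⌋` columns and, if `m` is odd, also the column `0`. -/
def IsKernelColumn (m N : ℕ) (k : Fin N) : Prop :=
  (Odd m ∧ (k : ℕ) = 0) ∨ (1 ≤ (k : ℕ) ∧ (k : ℕ) ≤ m / 2) ∨ N ≤ (k : ℕ) + m / 2

/-! ### Pseudo prolate spheroidal functions -/

/-- `φ` is an orthonormal basis of eigenvectors of `P` for all the eigenvalues `> 1 - σ`,
counted with multiplicity. -/
structure IsTopEigensystem {H : Type*} [NormedAddCommGroup H] [InnerProductSpace ℂ H]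
    (P : H →L[ℂ] H) (σ : ℝ) {n : ℕ} (φ : Fin n → H) : Prop where
  orthonormal : Orthonormal ℂ φ
  eigen : ∀ k, ∃ μ : ℝ, 1 - σ < μ ∧ P (φ k) = (μ : ℂ) • φ k
  complete : ∀ (f : H) (μ : ℝ), 1 - σ < μ → P f = (μ : ℂ) • f →
    f ∈ Submodule.span ℂ (Set.range φ)

/-- The data from which `m + n` pseudo prolate functions are formed: the `n` eigenfunctions with
eigenvalue `> 1 - σ`, `m` orthonormal vectors in the kernel, and an assignment of the columns of
`realDFT (m + n)` to these `n + m` vectors. -/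
structure Data {H : Type*} [NormedAddCommGroup H] [InnerProductSpace ℂ H]
    (P : H →L[ℂ] H) (σ : ℝ) (n m : ℕ) where
  φ : Fin n → H
  isTopEigensystem : IsTopEigensystem P σ φ
  h : Fin m → H
  orthonormal_h : Orthonormal ℂ h
  h_mem_ker : ∀ i, P (h i) = 0
  column : Fin n ⊕ Fin m ≃ Fin (m + n)
  column_inr : ∀ k : Fin (m + n), IsKernelColumn m (m + n) k ↔ ∃ i, column (Sum.inr i) = k

namespace Data

variable {H : Type*} [NormedAddCommGroup H] [InnerProductSpace ℂ H]
  {P : H →L[ℂ] H} {σ : ℝ} {n m : ℕ}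

/-- `ψ_j`, the component in the span of the eigenfunctions. -/
def eigenPart (S : Data P σ n m) (j : Fin (m + n)) : H :=
  ∑ k : Fin n, (realDFT (m + n) j (S.column (Sum.inl k)) : ℂ) • S.φ k

/-- `ρ_j`, the component in the span of the kernel vectors. -/
def kernelPart (S : Data P σ n m) (j : Fin (m + n)) : H :=
  ∑ i : Fin m, (realDFT (m + n) j (S.column (Sum.inr i)) : ℂ) • S.h i

/-- The pseudo prolate functions `Φ_j = ψ_j + ρ_j`. -/
def pseudoProlate (S : Data P σ n m) (j : Fin (m + n)) : H :=
  S.eigenPart j + S.kernelPart j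

end Data

/-- `γ = (ε - σ²) / (1 - σ²)`, the solution of `σ² + (1 - σ²) γ = ε`. -/
def kernelShare (ε σ : ℝ) : ℝ := (ε - σ ^ 2) / (1 - σ ^ 2)

end PseudoProlate

end

/-!
The operator `P_r = D_{rT} B_Ω D_{rT}` is `A†A` for `A = D_W 𝓕 D_{rT}`, where `W = Ω / (2π)` is the
set of frequencies in Mathlib's normalization (`limitingOp_eq`). Both `A` and `P_r` are
Hilbert–Schmidt, and their squared Hilbert–Schmidt norms, which are the sums `∑ λ` and `∑ λ²` over
the eigenvalues of `P_r`, are integrals of explicit kernels: `∑ λ = |W| |rT|`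
(`hsNormSq_timeBandOp`) and `∑ λ² = ∫_{rT} ∫_{rT} |K(y - x)|² dy dx` with `K` the inverse Fourier
transform of the indicator of `W` (`hsNormSq_adjoint_comp_timeBandOp`). Since `∫ |K|² = |W|`, the
difference `∑ λ (1 - λ)` is the mass that the kernel moves out of `rT`,
`r^d ∫ |K(u)|² |{x ∈ T : x + u/r ∉ T}| du` (`lintegral_add_leakage`, `leakage_smul`). This is
`o(r^d)` by dominated convergence, because translation is continuous in measure.

An eigenvalue `λ ≤ 1 - σ` contributes at most `λ (1 - λ) / σ` to `∑ λ`, so at least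
`(2π)^(-d) |T| |Ω| r^d - o(r^d) / σ` eigenvalues exceed `1 - σ` (`exists_isTopEigensystem`,
`exists_data_smul`). The kernel of `P_r` contains every function supported outside `rT` and is
infinite-dimensional, which supplies the vectors `h_i` (`exists_orthonormal_ker`).

In the rows of the real DFT matrix the squared entries are `(1 - sin (4πjk/N)) / N`. The set of
kernel columns is symmetric under `k ↦ -k`, so that the sines cancel, and every `Φ_j` has exactly
the share `m / (m + n)` of its squared norm in the kernel of `P_r` (`sum_kernelColumn_sq`);
on the remaining part `P_r - 1` has norm at most `σ` (`Data.norm_sub_sq_le`). Choosing `m` so that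
the share is at most `γ(σ)` multiplies the number of functions by `1 / (1 - γ(σ))` up to rounding
(`share_bounds`), and this factor tends to `1 / (1 - ε)` as `σ → 0`. The choice `slowSigma` lets
`σ(r)` tend to zero slowly enough that the error `o(r^d) / σ(r)` is still `o(r^d)`.

The maximal count is finite because each of `N` orthonormal almost fixed functions contributes at
least `(1 - √ε)²` to the squared Hilbert–Schmidt norm of `P_r` (`card_mul_le_hsNormSq`).
-/

noncomputable section

namespace PseudoProlate

universe u

/-! ### The real DFT matrix -/

theorem realDFT_apply {N : ℕ} (i j : Fin N) :
    realDFT N i j = (Real.sqrt N)⁻¹ *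
      (Real.cos ((i : ℕ) * (j : ℕ) * (2 * Real.pi / N)) -
        Real.sin ((i : ℕ) * (j : ℕ) * (2 * Real.pi / N))) := by
  have h : Complex.exp (-(2 * Real.pi * Complex.I) / N) ^ ((i : ℕ) * (j : ℕ)) =
      Complex.exp (((-((i : ℕ) * (j : ℕ) * (2 * Real.pi / N)) : ℝ) : ℂ) * Complex.I) := by
    rw [← Complex.exp_nat_mul]
    congr 1
    push_cast
    ring
  simp only [realDFT, dftMatrix, Matrix.of_apply, h, ← Complex.ofReal_inv, Complex.re_ofReal_mul,
    Complex.im_ofReal_mul, Complex.exp_ofReal_mul_I_re, Complex.exp_ofReal_mul_I_im,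
    Real.cos_neg, Real.sin_neg]
  ring

/-- Orthogonality of the characters of `ℤ/N`. -/
theorem sum_exp_eq {N : ℕ} (l : ℤ) (hN : 0 < N) :
    ∑ k : Fin N, Complex.exp (((k : ℕ) * (l * (2 * Real.pi / N)) : ℝ) * Complex.I) =
      if (N : ℤ) ∣ l then (N : ℂ) else 0 := by
  have hN' : (N : ℂ) ≠ 0 := by exact_mod_cast hN.ne'
  set z : ℂ := Complex.exp (2 * Real.pi * Complex.I * l / N) with hz
  have h1 : ∀ k : Fin N, Complex.exp (((k : ℕ) * (l * (2 * Real.pi / N)) : ℝ) * Complex.I) =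
      z ^ (k : ℕ) := by
    intro k
    rw [hz, ← Complex.exp_nat_mul]
    congr 1
    push_cast
    ring
  have hzN : z ^ N = 1 := by
    rw [hz, ← Complex.exp_nat_mul, Complex.exp_eq_one_iff]
    exact ⟨l, by field_simp⟩
  have hz1 : z = 1 ↔ (N : ℤ) ∣ l := by
    rw [hz, Complex.exp_eq_one_iff]
    constructor
    · rintro ⟨c, hc⟩
      refine ⟨c, ?_⟩
      have hpi : (2 * Real.pi * Complex.I : ℂ) ≠ 0 := Complex.two_pi_I_ne_zero
      have : (2 * Real.pi * Complex.I) * (l : ℂ) = (2 * Real.pi * Complex.I) * (N * c) := by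
        rw [div_eq_iff hN'] at hc
        rw [hc]; ring
      exact_mod_cast mul_left_cancel₀ hpi this
    · rintro ⟨c, rfl⟩
      refine ⟨c, ?_⟩
      push_cast
      field_simp
  simp only [h1]
  rw [Fin.sum_univ_eq_sum_range (fun k => z ^ k) N]
  split_ifs with h
  · simp [hz1.2 h]
  · have := geom_sum_mul z N
    rw [hzN, sub_self, mul_eq_zero, sub_eq_zero] at this
    exact this.resolve_right (fun h' => h (hz1.1 h'))

theorem sum_cos_eq {N : ℕ} (l : ℤ) (hN : 0 < N) :
    ∑ k : Fin N, Real.cos ((k : ℕ) * (l * (2 * Real.pi / N))) =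
      if (N : ℤ) ∣ l then (N : ℝ) else 0 := by
  have h := congrArg Complex.re (sum_exp_eq l hN)
  rw [Complex.re_sum] at h
  simp only [Complex.exp_ofReal_mul_I_re] at h
  rw [h]
  split_ifs <;> simp

theorem sum_sin_eq {N : ℕ} (l : ℤ) (hN : 0 < N) :
    ∑ k : Fin N, Real.sin ((k : ℕ) * (l * (2 * Real.pi / N))) = 0 := by
  have h := congrArg Complex.im (sum_exp_eq l hN)
  rw [Complex.im_sum] at h
  simp only [Complex.exp_ofReal_mul_I_im] at h
  rw [h]
  split_ifs <;> simp

/-- In the product `(cos a - sin a) (cos b - sin b) = cos (a - b) - sin (a + b)` the second term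
sums to zero over a column, which leaves the orthogonality of the characters. -/
theorem realDFT_transpose_mul (N : ℕ) : (realDFT N)ᵀ * realDFT N = 1 := by
  ext i j
  have hN : 0 < N := i.pos
  have hN' : (N : ℝ) ≠ 0 := by exact_mod_cast hN.ne'
  have key : ∀ k : Fin N, realDFT N k i * realDFT N k j = (N : ℝ)⁻¹ *
      (Real.cos ((k : ℕ) * (((i : ℤ) - (j : ℤ) : ℤ) * (2 * Real.pi / N))) -
        Real.sin ((k : ℕ) * (((i : ℤ) + (j : ℤ) : ℤ) * (2 * Real.pi / N)))) := by
    intro k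
    rw [realDFT_apply, realDFT_apply]
    have hs : (N : ℝ)⁻¹ = (Real.sqrt N)⁻¹ * (Real.sqrt N)⁻¹ := by
      rw [← mul_inv, Real.mul_self_sqrt (Nat.cast_nonneg N)]
    have e1 : ((k : ℕ) : ℝ) * (((i : ℤ) - (j : ℤ) : ℤ) * (2 * Real.pi / N)) =
      (k : ℕ) * (i : ℕ) * (2 * Real.pi / N) - (k : ℕ) * (j : ℕ) * (2 * Real.pi / N) := by
      push_cast; ring
    have e2 : ((k : ℕ) : ℝ) * (((i : ℤ) + (j : ℤ) : ℤ) * (2 * Real.pi / N)) =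
      (k : ℕ) * (i : ℕ) * (2 * Real.pi / N) + (k : ℕ) * (j : ℕ) * (2 * Real.pi / N) := by
      push_cast; ring
    rw [e1, e2, Real.cos_sub, Real.sin_add, hs]
    ring
  rw [Matrix.mul_apply]
  simp only [Matrix.transpose_apply, key]
  rw [← Finset.mul_sum, Finset.sum_sub_distrib, sum_cos_eq _ hN, sum_sin_eq _ hN, Matrix.one_apply]
  have hdvd : (N : ℤ) ∣ (i : ℤ) - (j : ℤ) ↔ i = j := by
    constructor
    · intro h
      have hi := i.isLt
      have hj := j.isLt
      have : (i : ℤ) - (j : ℤ) = 0 := Int.eq_zero_of_abs_lt_dvd h (by rw [abs_lt]; omega)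
      exact Fin.ext (by omega)
    · rintro rfl
      simp
  simp only [hdvd]
  split_ifs <;> simp [hN']

theorem realDFT_mul_transpose (N : ℕ) : realDFT N * (realDFT N)ᵀ = 1 :=
  mul_eq_one_comm.1 (realDFT_transpose_mul N)

/-! ### The kernel columns -/

theorem isKernelColumn_neg {m n : ℕ} [NeZero (m + n)] (k : Fin (m + n))
    (hk : IsKernelColumn m (m + n) k) : IsKernelColumn m (m + n) (-k) := by
  have hlt := k.isLt
  unfold IsKernelColumn at *
  rw [Fin.val_neg]
  split_ifs with h0
  · subst h0
    simpa using hk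
  · have : (k : ℕ) ≠ 0 := fun h => h0 (Fin.ext h)
    omega

theorem isKernelColumn_neg_iff {m n : ℕ} [NeZero (m + n)] (k : Fin (m + n)) :
    IsKernelColumn m (m + n) (-k) ↔ IsKernelColumn m (m + n) k :=
  ⟨fun h => by simpa using isKernelColumn_neg _ h, isKernelColumn_neg k⟩

open Classical in
/-- The set of kernel columns is symmetric under `k ↦ -k` modulo `N`, so that the terms
`sin (4πjk/N)` of `|X'_{jk}|² = (1 - sin (4πjk/N)) / N` cancel. -/
theorem sum_kernelColumn_sq {m n : ℕ} (j : Fin (m + n)) :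
    ∑ k ∈ Finset.univ.filter (IsKernelColumn m (m + n)), realDFT (m + n) j k ^ 2 =
      (Finset.univ.filter (IsKernelColumn m (m + n))).card / ((m + n : ℕ) : ℝ) := by
  have hN : 0 < m + n := j.pos
  have : NeZero (m + n) := ⟨hN.ne'⟩
  have hN' : ((m + n : ℕ) : ℝ) ≠ 0 := by exact_mod_cast hN.ne'
  have key : ∀ k : Fin (m + n), realDFT (m + n) j k ^ 2 = ((m + n : ℕ) : ℝ)⁻¹ *
      (1 - Real.sin (2 * ((j : ℕ) * (k : ℕ) * (2 * Real.pi / (m + n : ℕ))))) := by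
    intro k
    rw [realDFT_apply, mul_pow, inv_pow, Real.sq_sqrt (Nat.cast_nonneg _), Real.sin_two_mul,
      sub_sq, ← Real.sin_sq_add_cos_sq ((j : ℕ) * (k : ℕ) * (2 * Real.pi / (m + n : ℕ)))]
    ring
  have hsin : ∀ k : Fin (m + n),
      Real.sin (2 * ((j : ℕ) * ((-k : Fin (m + n)) : ℕ) * (2 * Real.pi / (m + n : ℕ)))) =
      -Real.sin (2 * ((j : ℕ) * (k : ℕ) * (2 * Real.pi / (m + n : ℕ)))) := by
    intro k
    rw [Fin.val_neg]
    split_ifs with h0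
    · simp [h0]
    · rw [Nat.cast_sub k.isLt.le, ← Real.sin_neg,
        ← Real.sin_add_nat_mul_two_pi (-_) (2 * (j : ℕ))]
      congr 1
      push_cast
      push_cast at hN'
      field_simp
      ring
  have hzero : ∑ k ∈ Finset.univ.filter (IsKernelColumn m (m + n)),
      Real.sin (2 * ((j : ℕ) * (k : ℕ) * (2 * Real.pi / (m + n : ℕ)))) = 0 := by
    rw [Finset.sum_filter]
    have h := Equiv.sum_comp (Equiv.neg (Fin (m + n))) (fun k => if IsKernelColumn m (m + n) k then
      Real.sin (2 * ((j : ℕ) * (k : ℕ) * (2 * Real.pi / (m + n : ℕ)))) else 0)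
    simp only [Equiv.neg_apply, isKernelColumn_neg_iff, hsin] at h
    have h2 : ∀ k : Fin (m + n), (if IsKernelColumn m (m + n) k then
        -Real.sin (2 * ((j : ℕ) * (k : ℕ) * (2 * Real.pi / (m + n : ℕ)))) else 0) =
        -(if IsKernelColumn m (m + n) k then
          Real.sin (2 * ((j : ℕ) * (k : ℕ) * (2 * Real.pi / (m + n : ℕ)))) else 0) := by
      intro k; split_ifs <;> simp
    simp only [h2, Finset.sum_neg_distrib] at h
    linarith
  simp only [key]
  rw [← Finset.mul_sum, Finset.sum_sub_distrib, hzero]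
  simp [div_eq_inv_mul]

open Classical in
theorem card_kernelColumn {m n : ℕ} (h : 0 < n ∨ m = 0) :
    (Finset.univ.filter (IsKernelColumn m (m + n))).card = m := by
  -- The three pieces are disjoint, as `m = 0` or `2 * (m / 2) < m + n`.
  have hmap : (Finset.univ.filter (IsKernelColumn m (m + n))).map Fin.valEmbedding =
      (if Odd m then {0} else ∅) ∪ (Finset.Icc 1 (m / 2) ∪ Finset.Ico (m + n - m / 2) (m + n)) := by
    ext k
    simp only [Finset.mem_map, Finset.mem_filter, Finset.mem_univ, true_and, Fin.valEmbedding_apply,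
      IsKernelColumn, Finset.mem_union, Finset.mem_Icc, Finset.mem_Ico]
    constructor
    · rintro ⟨k, hk, rfl⟩
      have := k.isLt
      rcases hk with ⟨ho, hk⟩ | hk | hk
      · simp [ho, hk]
      · exact Or.inr (Or.inl hk)
      · exact Or.inr (Or.inr (by omega))
    · intro hk
      split_ifs at hk with ho
      · simp only [Finset.mem_singleton] at hk
        have : 0 < m := ho.pos
        exact ⟨⟨k, by omega⟩, by simp only [ho, true_and]; omega, rfl⟩
      · simp only [Finset.notMem_empty, false_or] at hk
        exact ⟨⟨k, by omega⟩, by simp only [ho, false_and, false_or]; omega, rfl⟩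
  rw [← Finset.card_map Fin.valEmbedding, hmap, Finset.card_union_of_disjoint,
    Finset.card_union_of_disjoint]
  · simp only [Nat.card_Icc, Nat.card_Ico]
    split_ifs with ho
    · obtain ⟨c, rfl⟩ := ho
      simp only [Finset.card_singleton]; omega
    · obtain ⟨c, rfl⟩ := Nat.not_odd_iff_even.1 ho
      simp only [Finset.card_empty]; omega
  · rw [Finset.disjoint_left]
    intro a
    simp only [Finset.mem_Icc, Finset.mem_Ico]
    omega
  · rw [Finset.disjoint_left]
    intro a
    split_ifs with ho
    · obtain ⟨c, rfl⟩ := ho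
      simp only [Finset.mem_singleton, Finset.mem_union, Finset.mem_Icc, Finset.mem_Ico]
      omega
    · simp

/-- The columns can be assigned as the construction prescribes. -/
theorem exists_column {m n : ℕ} (h : 0 < n ∨ m = 0) :
    ∃ e : Fin n ⊕ Fin m ≃ Fin (m + n),
      ∀ k, IsKernelColumn m (m + n) k ↔ ∃ i, e (Sum.inr i) = k := by
  classical
  have hc := card_kernelColumn h
  have h1 : Fintype.card {k // IsKernelColumn m (m + n) k} = m := by
    rw [Fintype.card_subtype, hc]
  have h2 : Fintype.card {k // ¬ IsKernelColumn m (m + n) k} = n := by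
    rw [Fintype.card_subtype_compl, h1, Fintype.card_fin]; omega
  let e1 := (Fintype.equivFinOfCardEq h1).symm
  let e2 := (Fintype.equivFinOfCardEq h2).symm
  refine ⟨((Equiv.sumCongr e2 e1).trans (Equiv.sumComm _ _)).trans (Equiv.sumCompl _), ?_⟩
  intro k
  constructor
  · intro hk
    exact ⟨e1.symm ⟨k, hk⟩, by simp⟩
  · rintro ⟨i, rfl⟩
    simpa using (e1 i).2

/-! ### Algebraic properties of pseudo prolate functions -/

section Combination

variable {H : Type*} [NormedAddCommGroup H] [InnerProductSpace ℂ H] {N : ℕ}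
  {U : Matrix (Fin N) (Fin N) ℝ} {w : Fin N → H}

/-- An orthogonal matrix takes an orthonormal system to an orthonormal system. -/
theorem orthonormal_sum_smul (hU : U * Uᵀ = 1) (hw : Orthonormal ℂ w) :
    Orthonormal ℂ (fun j => ∑ k, (U j k : ℂ) • w k) := by
  classical
  rw [orthonormal_iff_ite]
  intro i j
  rw [hw.inner_sum]
  have h := congrFun (congrFun hU i) j
  rw [Matrix.mul_apply, Matrix.one_apply] at h
  have h' := congrArg (fun x : ℝ => (x : ℂ)) h
  simp only [Matrix.transpose_apply] at h'
  push_cast at h'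
  simp only [Complex.conj_ofReal]
  rw [h']
  split_ifs <;> simp

theorem span_sum_smul (hU : Uᵀ * U = 1) :
    Submodule.span ℂ (Set.range fun j => ∑ k, (U j k : ℂ) • w k) =
      Submodule.span ℂ (Set.range w) := by
  apply le_antisymm
  · rw [Submodule.span_le]
    rintro _ ⟨j, rfl⟩
    exact Submodule.sum_mem _ fun k _ =>
      Submodule.smul_mem _ _ (Submodule.subset_span ⟨k, rfl⟩)
  · rw [Submodule.span_le]
    rintro _ ⟨l, rfl⟩
    have : w l = ∑ j, (U j l : ℂ) • ∑ k, (U j k : ℂ) • w k := by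
      simp only [Finset.smul_sum, smul_smul]
      rw [Finset.sum_comm]
      have h : ∀ k, ∑ j, ((U j l : ℂ) * (U j k : ℂ)) • w k = if l = k then w k else 0 := by
        intro k
        rw [← Finset.sum_smul]
        have h := congrFun (congrFun hU l) k
        rw [Matrix.mul_apply, Matrix.one_apply] at h
        have h' := congrArg (fun x : ℝ => (x : ℂ)) h
        simp only [Matrix.transpose_apply] at h'
        push_cast at h'
        rw [h']
        split_ifs <;> simp
      simp [h]
    rw [this]
    exact Submodule.sum_mem _ fun j _ =>
      Submodule.smul_mem _ _ (Submodule.subset_span ⟨j, rfl⟩)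

theorem norm_sq_sum_smul {ι : Type*} [Fintype ι] {v : ι → H} (hv : Orthonormal ℂ v) (c : ι → ℝ) :
    ‖∑ i, (c i : ℂ) • v i‖ ^ 2 = ∑ i, c i ^ 2 := by
  have h := hv.inner_sum (fun i => (c i : ℂ)) (fun i => (c i : ℂ)) Finset.univ
  rw [inner_self_eq_norm_sq_to_K] at h
  simp only [Complex.conj_ofReal] at h
  apply Complex.ofReal_injective
  push_cast
  simp only [sq] at h ⊢
  exact h

end Combination

namespace Data

variable {H : Type*} [NormedAddCommGroup H] [InnerProductSpace ℂ H]
  {P : H →L[ℂ] H} {σ : ℝ} {n m : ℕ}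

/-- The vectors that are combined, in the order of the columns of the matrix. -/
def vec (S : Data P σ n m) (k : Fin (m + n)) : H := Sum.elim S.φ S.h (S.column.symm k)

theorem pseudoProlate_eq_sum (S : Data P σ n m) (j : Fin (m + n)) :
    S.pseudoProlate j = ∑ k, (realDFT (m + n) j k : ℂ) • S.vec k := by
  rw [← S.column.sum_comp, Fintype.sum_sum_type]
  simp [pseudoProlate, eigenPart, kernelPart, vec]

theorem range_vec (S : Data P σ n m) : Set.range S.vec = Set.range S.φ ∪ Set.range S.h := by
  have : S.vec = Sum.elim S.φ S.h ∘ S.column.symm := rfl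
  rw [this, S.column.symm.surjective.range_comp, Set.Sum.elim_range]

theorem inner_φ_of_mem_ker (S : Data P σ n m) (hP : P.IsSymmetric) (hσ : σ < 1)
    (k : Fin n) {g : H} (hg : P g = 0) : inner ℂ g (S.φ k) = 0 := by
  obtain ⟨μ, hμ, h⟩ := S.isTopEigensystem.eigen k
  have h1 : inner ℂ (P g) (S.φ k) = inner ℂ g (P (S.φ k)) := hP g (S.φ k)
  rw [hg, inner_zero_left, h, inner_smul_right] at h1
  have hμ0 : (μ : ℂ) ≠ 0 := by
    have : μ ≠ 0 := by linarith
    exact_mod_cast this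
  exact (mul_eq_zero.1 h1.symm).resolve_left hμ0

theorem orthonormal_vec (S : Data P σ n m) (hP : P.IsSymmetric) (hσ : σ < 1) :
    Orthonormal ℂ S.vec := by
  classical
  have h : Orthonormal ℂ (Sum.elim S.φ S.h) := by
    have hφ := orthonormal_iff_ite.1 S.isTopEigensystem.orthonormal
    have hh := orthonormal_iff_ite.1 S.orthonormal_h
    rw [orthonormal_iff_ite]
    rintro (i | i) (j | j)
    · simp [hφ]
    · simp [inner_eq_zero_symm.1 (S.inner_φ_of_mem_ker hP hσ i (S.h_mem_ker j))]
    · simp [S.inner_φ_of_mem_ker hP hσ j (S.h_mem_ker i)]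
    · simp [hh]
  exact h.comp _ S.column.symm.injective

theorem orthonormal_pseudoProlate (S : Data P σ n m) (hP : P.IsSymmetric) (hσ : σ < 1) :
    Orthonormal ℂ S.pseudoProlate := by
  rw [funext S.pseudoProlate_eq_sum]
  exact orthonormal_sum_smul (realDFT_mul_transpose _) (S.orthonormal_vec hP hσ)

theorem span_pseudoProlate (S : Data P σ n m) :
    Submodule.span ℂ (Set.range S.pseudoProlate) =
      Submodule.span ℂ (Set.range S.φ) ⊔ Submodule.span ℂ (Set.range S.h) := by
  rw [funext S.pseudoProlate_eq_sum, span_sum_smul (realDFT_transpose_mul _), S.range_vec,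
    Submodule.span_union]

theorem apply_kernelPart (S : Data P σ n m) (j : Fin (m + n)) : P (S.kernelPart j) = 0 := by
  simp [kernelPart, S.h_mem_ker]

theorem inner_eigenPart_of_mem_ker (S : Data P σ n m) (hP : P.IsSymmetric) (hσ : σ < 1)
    (j : Fin (m + n)) {g : H} (hg : P g = 0) : inner ℂ g (S.eigenPart j) = 0 := by
  simp only [eigenPart, inner_sum, inner_smul_right]
  exact Finset.sum_eq_zero fun k _ => by rw [S.inner_φ_of_mem_ker hP hσ k hg, mul_zero]

theorem sum_sq_kernelColumns (S : Data P σ n m) (j : Fin (m + n)) :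
    ∑ i, realDFT (m + n) j (S.column (Sum.inr i)) ^ 2 = (m : ℝ) / (m + n) := by
  classical
  have hinj : Function.Injective fun i : Fin m => S.column (Sum.inr i) :=
    S.column.injective.comp Sum.inr_injective
  have hf : Finset.univ.filter (IsKernelColumn m (m + n)) =
      Finset.univ.image fun i : Fin m => S.column (Sum.inr i) := by
    ext k
    simp [S.column_inr]
  have h := sum_kernelColumn_sq j
  rw [hf, Finset.sum_image hinj.injOn, Finset.card_image_of_injective _ hinj] at h
  rw [h]
  simp

theorem norm_kernelPart_sq (S : Data P σ n m) (j : Fin (m + n)) :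
    ‖S.kernelPart j‖ ^ 2 = (m : ℝ) / (m + n) := by
  rw [kernelPart, norm_sq_sum_smul S.orthonormal_h, S.sum_sq_kernelColumns]

theorem sum_sq_eigenColumns (S : Data P σ n m) (j : Fin (m + n)) :
    ∑ k, realDFT (m + n) j (S.column (Sum.inl k)) ^ 2 = 1 - (m : ℝ) / (m + n) := by
  have h : ∑ k, realDFT (m + n) j k ^ 2 = 1 := by
    have h := congrFun (congrFun (realDFT_mul_transpose (m + n)) j) j
    rw [Matrix.mul_apply, Matrix.one_apply_eq] at h
    simp only [sq]
    exact h
  rw [← S.column.sum_comp, Fintype.sum_sum_type, S.sum_sq_kernelColumns] at h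
  linarith

/-- `P Φ - Φ = (P ψ - ψ) - ρ` is an orthogonal decomposition; on the eigenfunctions `P - 1` acts
by numbers of modulus less than `σ`. -/
theorem norm_sub_sq_le (S : Data P σ n m) (hP : P.IsSymmetric) (hP1 : ‖P‖ ≤ 1) (hσ : σ < 1)
    (j : Fin (m + n)) :
    ‖P (S.pseudoProlate j) - S.pseudoProlate j‖ ^ 2 ≤
      σ ^ 2 + (1 - σ ^ 2) * ((m : ℝ) / (m + n)) := by
  choose μ hμ hμe using S.isTopEigensystem.eigen
  have hμ1 : ∀ k, μ k ≤ 1 := by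
    intro k
    have h1 : ‖P (S.φ k)‖ ≤ 1 * ‖S.φ k‖ := P.le_of_opNorm_le hP1 _
    rw [hμe, norm_smul, S.isTopEigensystem.orthonormal.1 k, Complex.norm_real,
      Real.norm_eq_abs] at h1
    linarith [le_abs_self (μ k)]
  have hψ : P (S.eigenPart j) - S.eigenPart j =
      ∑ k, ((realDFT (m + n) j (S.column (Sum.inl k)) * (μ k - 1) : ℝ) : ℂ) • S.φ k := by
    simp only [eigenPart, map_sum, map_smul, hμe, ← Finset.sum_sub_distrib]
    refine Finset.sum_congr rfl fun k _ => ?_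
    rw [smul_smul, ← sub_smul]
    congr 1
    push_cast; ring
  have hdec : P (S.pseudoProlate j) - S.pseudoProlate j =
      (P (S.eigenPart j) - S.eigenPart j) - S.kernelPart j := by
    rw [pseudoProlate, map_add, S.apply_kernelPart]
    abel
  have horth : inner ℂ (P (S.eigenPart j) - S.eigenPart j) (S.kernelPart j) = 0 := by
    rw [hψ, sum_inner]
    refine Finset.sum_eq_zero fun k _ => ?_
    rw [inner_smul_left,
      inner_eq_zero_symm.1 (S.inner_φ_of_mem_ker hP hσ k (S.apply_kernelPart j)), mul_zero]
  have hpyth : ‖P (S.pseudoProlate j) - S.pseudoProlate j‖ ^ 2 =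
      ‖P (S.eigenPart j) - S.eigenPart j‖ ^ 2 + ‖S.kernelPart j‖ ^ 2 := by
    rw [hdec, @norm_sub_sq ℂ, horth]
    simp
  have hσ0 : ∀ k, (μ k - 1) ^ 2 ≤ σ ^ 2 := by
    intro k
    have h1 := hμ k
    have h2 := hμ1 k
    nlinarith
  have hle : ‖P (S.eigenPart j) - S.eigenPart j‖ ^ 2 ≤ σ ^ 2 * (1 - (m : ℝ) / (m + n)) := by
    rw [hψ, norm_sq_sum_smul S.isTopEigensystem.orthonormal, ← S.sum_sq_eigenColumns j,
      Finset.mul_sum]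
    refine Finset.sum_le_sum fun k _ => ?_
    rw [mul_pow, mul_comm]
    exact mul_le_mul_of_nonneg_right (hσ0 k) (sq_nonneg _)
  rw [hpyth, S.norm_kernelPart_sq]
  linarith

end Data

/-! ### Hilbert–Schmidt operators and their spectrum -/

section HilbertSchmidt

variable {H : Type*} [NormedAddCommGroup H] [InnerProductSpace ℂ H]

theorem enorm_sq_eq_tsum_inner {ι : Type*} (b : HilbertBasis ι ℂ H) (x : H) :
    ‖x‖ₑ ^ 2 = ∑' i, ‖inner ℂ (b i) x‖ₑ ^ 2 := by
  have h := b.hasSum_inner_mul_inner x x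
  have h2 : HasSum (fun i => ‖inner ℂ (b i) x‖ ^ 2) (‖x‖ ^ 2) := by
    have h3 := Complex.hasSum_re h
    rw [inner_self_eq_norm_sq_to_K] at h3
    have h4 : ∀ i, (inner ℂ x (b i) * inner ℂ (b i) x).re = ‖inner ℂ (b i) x‖ ^ 2 := by
      intro i
      rw [← inner_conj_symm, ← Complex.normSq_eq_conj_mul_self, Complex.normSq_eq_norm_sq,
        Complex.ofReal_re]
    simp only [h4] at h3
    convert h3 using 1
    norm_cast
  have e : ∀ {E : Type _} [NormedAddCommGroup E] (y : E), ‖y‖ₑ ^ 2 = ENNReal.ofReal (‖y‖ ^ 2) := by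
    intro E _ y
    rw [← ofReal_norm, ENNReal.ofReal_pow (norm_nonneg y)]
  rw [e, ← h2.tsum_eq, ENNReal.ofReal_tsum_of_nonneg (fun i => by positivity) h2.summable]
  simp only [ENNReal.ofReal_pow (norm_nonneg _), ofReal_norm]

/-- The index set of a Hilbert basis of a separable space is countable. -/
theorem countable_hilbertBasis [TopologicalSpace.SeparableSpace H] {ι : Type*}
    (b : HilbertBasis ι ℂ H) : Countable ι := by
  have hd : (Set.univ : Set ι).PairwiseDisjoint fun i => Metric.ball (b i) (1 / 2) := by
    intro i _ j _ hij
    apply Metric.ball_disjoint_ball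
    have h : dist (b i) (b j) ^ 2 = 2 := by
      rw [dist_eq_norm, @norm_sub_sq ℂ, b.orthonormal.2 hij, b.orthonormal.1 i, b.orthonormal.1 j]
      norm_num
    nlinarith [dist_nonneg (x := b i) (y := b j)]
  rw [← Set.countable_univ_iff]
  exact hd.countable_of_isOpen (fun i _ => Metric.isOpen_ball)
    (fun i _ => ⟨b i, Metric.mem_ball_self (by norm_num)⟩)

/-- The square of the Hilbert–Schmidt norm, computed in a Hilbert basis. -/
def hsNormSq {ι : Type*} (b : HilbertBasis ι ℂ H) (A : H →L[ℂ] H) : ℝ≥0∞ :=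
  ∑' i, ‖A (b i)‖ₑ ^ 2

variable {ι κ : Type*} (b : HilbertBasis ι ℂ H) (c : HilbertBasis κ ℂ H)

/-- The truncation of an operator to finitely many vectors of a Hilbert basis. -/
def truncation (A : H →L[ℂ] H) (s : Finset ι) : H →L[ℂ] H :=
  ∑ i ∈ s, (innerSL ℂ (b i)).smulRight (A (b i))

theorem isCompactOperator_truncation (A : H →L[ℂ] H) (s : Finset ι) :
    IsCompactOperator (truncation b A s) := by
  have h : truncation b A s ∈ compactOperator (RingHom.id ℂ) H H := by
    refine Submodule.sum_mem _ fun i _ => ?_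
    have h1 : IsCompactOperator (innerSL ℂ (b i)) := isCompactOperator_of_locallyCompactSpace_dom _
    exact h1.clm_comp (ContinuousLinearMap.toSpanSingleton ℂ (A (b i)))
  exact h

open Classical in
theorem sub_truncation_apply (A : H →L[ℂ] H) (s : Finset ι) (i : ι) :
    (A - truncation b A s) (b i) = if i ∈ s then 0 else A (b i) := by
  have h := orthonormal_iff_ite.1 b.orthonormal
  simp only [truncation, _root_.sub_apply, _root_.sum_apply,
    ContinuousLinearMap.smulRight_apply, innerSL_apply_apply, h, ite_smul, one_smul, zero_smul,
    Finset.sum_ite_eq']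
  split_ifs <;> simp

variable [CompleteSpace H]

/-- Expanding `‖A b_i‖²` in the basis `c` gives the double sum `∑ |⟪c_j, A b_i⟫|²`, which is the one
that arises for `A†` with the bases exchanged. -/
theorem hsNormSq_eq_hsNormSq_adjoint (A : H →L[ℂ] H) :
    hsNormSq b A = hsNormSq c (ContinuousLinearMap.adjoint A) := by
  simp only [hsNormSq]
  simp only [enorm_sq_eq_tsum_inner c (A _),
    enorm_sq_eq_tsum_inner b (ContinuousLinearMap.adjoint A _)]
  rw [ENNReal.tsum_comm]
  refine tsum_congr fun j => tsum_congr fun i => ?_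
  rw [ContinuousLinearMap.adjoint_inner_right, ← inner_conj_symm, RCLike.enorm_conj]

theorem hsNormSq_congr_basis (A : H →L[ℂ] H) : hsNormSq b A = hsNormSq c A := by
  rw [hsNormSq_eq_hsNormSq_adjoint b c A, hsNormSq_eq_hsNormSq_adjoint c c A]

theorem hsNormSq_adjoint (A : H →L[ℂ] H) :
    hsNormSq b (ContinuousLinearMap.adjoint A) = hsNormSq b A :=
  (hsNormSq_eq_hsNormSq_adjoint b b A).symm

theorem enorm_apply_sq_le (A : H →L[ℂ] H) (x : H) :
    ‖A x‖ₑ ^ 2 ≤ hsNormSq b A * ‖x‖ₑ ^ 2 := by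
  rw [← hsNormSq_adjoint b A, hsNormSq, ← ENNReal.tsum_mul_right, enorm_sq_eq_tsum_inner b (A x)]
  refine ENNReal.tsum_le_tsum fun i => ?_
  rw [← ContinuousLinearMap.adjoint_inner_left, ← mul_pow]
  gcongr
  rw [← ofReal_norm, ← ofReal_norm, ← ofReal_norm, ← ENNReal.ofReal_mul (norm_nonneg _)]
  exact ENNReal.ofReal_le_ofReal (norm_inner_le_norm _ _)

/-- A Hilbert–Schmidt operator is the norm limit of its truncations, as the Hilbert–Schmidt norm of
the difference is a tail of a convergent series and dominates the operator norm. -/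
theorem isCompactOperator_of_hsNormSq_ne_top {A : H →L[ℂ] H} (hA : hsNormSq b A ≠ ⊤) :
    IsCompactOperator A := by
  classical
  have hlim := ENNReal.tendsto_tsum_compl_atTop_zero hA
  have hhs : ∀ s : Finset ι, hsNormSq b (A - truncation b A s) =
      ∑' i : {x // x ∉ s}, ‖A (b i)‖ₑ ^ 2 := by
    intro s
    have h : (∑' i : {x // x ∉ s}, ‖A (b i)‖ₑ ^ 2) = ∑' i, ({x | x ∉ s} : Set ι).indicator
        (fun i => ‖A (b i)‖ₑ ^ 2) i := tsum_subtype ({x | x ∉ s} : Set ι) fun i => ‖A (b i)‖ₑ ^ 2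
    rw [h]
    refine tsum_congr fun i => ?_
    rw [sub_truncation_apply]
    by_cases hi : i ∈ s <;> simp [hi]
  have hnorm : ∀ s : Finset ι, ‖truncation b A s - A‖ₑ ^ 2 ≤
      ∑' i : {x // x ∉ s}, ‖A (b i)‖ₑ ^ 2 := by
    intro s
    rw [← hhs, enorm_sub_rev]
    have hfin : hsNormSq b (A - truncation b A s) ≠ ⊤ := by
      rw [hhs]
      exact ne_top_of_le_ne_top hA (ENNReal.tsum_comp_le_tsum_of_injective
        Subtype.val_injective fun i => ‖A (b i)‖ₑ ^ 2)
    generalize A - truncation b A s = B at hfin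
    -- The Hilbert–Schmidt norm dominates the operator norm.
    have hB : ‖B‖ ≤ Real.sqrt (hsNormSq b B).toReal := by
      refine B.opNorm_le_bound (Real.sqrt_nonneg _) fun x => ?_
      have h := ENNReal.toReal_mono (ENNReal.mul_ne_top hfin (by simp)) (enorm_apply_sq_le b B x)
      rw [ENNReal.toReal_mul, ENNReal.toReal_pow, ENNReal.toReal_pow, toReal_enorm,
        toReal_enorm] at h
      rw [← Real.sqrt_sq (norm_nonneg x), ← Real.sqrt_mul ENNReal.toReal_nonneg]
      exact Real.le_sqrt_of_sq_le h
    rw [← ENNReal.ofReal_toReal hfin, ← ofReal_norm, ← ENNReal.ofReal_pow (norm_nonneg _)]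
    apply ENNReal.ofReal_le_ofReal
    calc ‖B‖ ^ 2 ≤ Real.sqrt (hsNormSq b B).toReal ^ 2 := by gcongr
      _ = _ := Real.sq_sqrt ENNReal.toReal_nonneg
  refine isCompactOperator_of_tendsto (l := atTop) (F := truncation b A) ?_
    (Eventually.of_forall fun s => isCompactOperator_truncation b A s)
  rw [tendsto_iff_norm_sub_tendsto_zero]
  have h2 : Tendsto (fun s => ‖truncation b A s - A‖ₑ ^ 2) atTop (𝓝 0) :=
    tendsto_of_tendsto_of_tendsto_of_le_of_le tendsto_const_nhds hlim (fun _ => zero_le) hnorm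
  have h3 := (ENNReal.tendsto_toReal ENNReal.zero_ne_top).comp h2
  have h4 := h3.sqrt
  simpa [Function.comp_def, ENNReal.toReal_pow] using h4

/-- Diagonalization of compact self-adjoint operators in a Hilbert basis. -/
theorem exists_eigenbasis {H : Type u} [NormedAddCommGroup H] [InnerProductSpace ℂ H]
    [CompleteSpace H] {P : H →L[ℂ] H} (hc : IsCompactOperator P) (hs : P.IsSymmetric) :
    ∃ (κ : Type u) (c : HilbertBasis κ ℂ H) (ν : κ → ℂ), ∀ i, P (c i) = ν i • c i := by
  have hE : ∀ μ : ℂ, CompleteSpace (Module.End.eigenspace (P : Module.End ℂ H) μ) := by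
    intro μ
    have : IsClosed (Module.End.eigenspace (P : Module.End ℂ H) μ : Set H) := by
      have h : (Module.End.eigenspace (P : Module.End ℂ H) μ : Set H) =
          {x | P x = μ • x} := by
        ext x
        simp
      rw [h]
      exact isClosed_eq P.continuous (continuous_const_smul μ)
    exact this.completeSpace_coe
  choose w bw _ using fun μ : ℂ => exists_hilbertBasis ℂ
    (Module.End.eigenspace (P : Module.End ℂ H) μ)
  have hof := hs.orthogonalFamily_eigenspaces
  have hon := hof.orthonormal_sigma_orthonormal (fun μ => (bw μ).orthonormal)
  let c := HilbertBasis.mkOfOrthogonalEqBot hon (by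
    rw [eq_bot_iff, ← ContinuousLinearMap.orthogonalComplement_iSup_eigenspaces_eq_bot hc hs]
    intro x hx
    rw [Submodule.mem_orthogonal] at hx
    rw [← Submodule.iInf_orthogonal, Submodule.mem_iInf]
    intro μ
    rw [Submodule.mem_orthogonal]
    intro u hu
    have h1 : ∀ i, inner ℂ ((bw μ i : H)) x = 0 := fun i =>
      hx _ (Submodule.subset_span ⟨⟨μ, i⟩, rfl⟩)
    have h2 := (bw μ).hasSum_repr ⟨u, hu⟩
    have h3 : HasSum (fun i => inner ℂ ((((bw μ).repr ⟨u, hu⟩ i • bw μ i :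
        Module.End.eigenspace (P : Module.End ℂ H) μ)) : H) x) (inner ℂ u x) := by
      have h4 := h2.mapL (Submodule.subtypeL _)
      have h5 := h4.map ((innerSLFlip ℂ x)) (innerSLFlip ℂ x).continuous
      simpa [Function.comp_def, mul_comm] using h5
    have h6 : (fun i => inner ℂ ((((bw μ).repr ⟨u, hu⟩ i • bw μ i :
        Module.End.eigenspace (P : Module.End ℂ H) μ)) : H) x) = fun _ => 0 := by
      funext i
      rw [Submodule.coe_smul, inner_smul_left, h1, mul_zero]
    rw [h6] at h3
    exact h3.unique hasSum_zero)
  refine ⟨_, c, fun i => i.1, fun i => ?_⟩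
  have : c i = (bw i.1 i.2 : H) := by
    simp [c, HilbertBasis.coe_mkOfOrthogonalEqBot]
  rw [this]
  exact Module.End.mem_eigenspace_iff.1 (bw i.1 i.2).2

/-- If `A` is a Hilbert–Schmidt contraction and `P = A†A`, then the eigenvalues `λ` of `P` satisfy
`∑ λ = hsNormSq b A` and `∑ λ² = hsNormSq b P`. As `σ λ ≤ σ 1_{λ > 1 - σ} + λ (1 - λ)` on `[0, 1]`,
this bounds the number of eigenvalues above `1 - σ` from below. -/
theorem exists_isTopEigensystem {A P : H →L[ℂ] H}
    (hP : P = ContinuousLinearMap.adjoint A ∘L A) (hA1 : ‖A‖ ≤ 1) (hA : hsNormSq b A ≠ ⊤)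
    {σ : ℝ} (hσ0 : 0 < σ) (hσ1 : σ < 1) :
    ∃ (n : ℕ) (φ : Fin n → H), IsTopEigensystem P σ φ ∧
      ENNReal.ofReal σ * hsNormSq b A + hsNormSq b P ≤ ENNReal.ofReal σ * n + hsNormSq b A := by
  classical
  have hc : IsCompactOperator P := by
    rw [hP]
    exact (isCompactOperator_of_hsNormSq_ne_top b hA).clm_comp (ContinuousLinearMap.adjoint A)
  have hPin : ∀ x y, inner ℂ x (P y) = inner ℂ (A x) (A y) := by
    intro x y
    rw [hP, ContinuousLinearMap.comp_apply, ContinuousLinearMap.adjoint_inner_right]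
  have hs : P.IsSymmetric := by
    intro x y
    change inner ℂ (P x) y = inner ℂ x (P y)
    rw [← inner_conj_symm, hPin, hPin, inner_conj_symm]
  obtain ⟨κ, c, ν, hν⟩ := exists_eigenbasis hc hs
  set l : κ → ℝ := fun i => ‖A (c i)‖ ^ 2 with hl
  have hνl : ∀ i, ν i = (l i : ℂ) := by
    intro i
    have h := hPin (c i) (c i)
    rw [hν, inner_smul_right, inner_self_eq_norm_sq_to_K, inner_self_eq_norm_sq_to_K,
      c.orthonormal.1 i] at h
    simpa [hl] using h
  have hPl : ∀ i, P (c i) = (l i : ℂ) • c i := fun i => by rw [hν, hνl]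
  have hl0 : ∀ i, 0 ≤ l i := fun i => by positivity
  have hl1 : ∀ i, l i ≤ 1 := by
    intro i
    have h : ‖A (c i)‖ ≤ 1 * ‖c i‖ := A.le_of_opNorm_le hA1 _
    rw [c.orthonormal.1 i, mul_one] at h
    exact pow_le_one₀ (norm_nonneg _) h
  have hle : ∀ i, ‖A (c i)‖ₑ ^ 2 = ENNReal.ofReal (l i) := fun i => by
    rw [hl, ENNReal.ofReal_pow (norm_nonneg _), ofReal_norm]
  have hle2 : ∀ i, ‖P (c i)‖ₑ ^ 2 = ENNReal.ofReal (l i ^ 2) := fun i => by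
    rw [hPl, ← ofReal_norm, norm_smul, c.orthonormal.1 i, mul_one, Complex.norm_real,
      Real.norm_of_nonneg (hl0 i), ENNReal.ofReal_pow (hl0 i)]
  have hτ : hsNormSq b A = ∑' i, ENNReal.ofReal (l i) := by
    rw [hsNormSq_congr_basis b c, hsNormSq]
    simp only [hle]
  have hτ2 : hsNormSq b P = ∑' i, ENNReal.ofReal (l i ^ 2) := by
    rw [hsNormSq_congr_basis b c, hsNormSq]
    simp only [hle2]
  have hfin : {i | 1 - σ < l i}.Finite := by
    refine (ENNReal.finite_const_le_of_tsum_ne_top (hτ ▸ hA)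
      (ε := ENNReal.ofReal (1 - σ)) ?_).subset ?_
    · simpa using hσ1
    · intro i hi
      exact ENNReal.ofReal_le_ofReal (le_of_lt hi)
  set s := hfin.toFinset with hsdef
  have hmem : ∀ i, i ∈ s ↔ 1 - σ < l i := by simp [hsdef]
  refine ⟨s.card, fun k => c (s.equivFin.symm k), ⟨?_, ?_, ?_⟩, ?_⟩
  · exact c.orthonormal.comp _ (Subtype.val_injective.comp s.equivFin.symm.injective)
  · intro k
    exact ⟨l _, (hmem _).1 (s.equivFin.symm k).2, hPl _⟩
  · intro f μ hμ hf
    have hzero : ∀ i, i ∉ s → c.repr f i = 0 := by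
      intro i hi
      rw [HilbertBasis.repr_apply_apply]
      have h : inner ℂ (P (c i)) f = inner ℂ (c i) (P f) := hs (c i) f
      rw [hPl, hf, inner_smul_left, inner_smul_right, Complex.conj_ofReal] at h
      have hne : (l i : ℂ) - μ ≠ 0 := by
        rw [hmem, not_lt] at hi
        have : l i - μ ≠ 0 := by linarith
        exact_mod_cast this
      have h' : ((l i : ℂ) - μ) * inner ℂ (c i) f = 0 := by rw [sub_mul, h, sub_self]
      exact (mul_eq_zero.1 h').resolve_left hne
    have hsum : f = ∑ i ∈ s, c.repr f i • c i :=
      (c.hasSum_repr f).unique (hasSum_sum_of_ne_finset_zero fun i hi => by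
        rw [hzero i hi, zero_smul])
    rw [hsum]
    refine Submodule.sum_mem _ fun i hi => Submodule.smul_mem _ _ (Submodule.subset_span ?_)
    exact ⟨s.equivFin ⟨i, hi⟩, by simp⟩
  · have hn : ENNReal.ofReal σ * (s.card : ℝ≥0∞) =
        ∑' i, ENNReal.ofReal (if i ∈ s then σ else 0) := by
      rw [tsum_eq_sum (s := s) (fun i hi => by simp [hi]), Finset.sum_congr rfl
        (g := fun _ => ENNReal.ofReal σ) (fun i hi => by simp [hi]), Finset.sum_const,
        nsmul_eq_mul, mul_comm]
    rw [hn, hτ, hτ2, ← ENNReal.tsum_mul_left, ← ENNReal.tsum_add, ← ENNReal.tsum_add]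
    refine ENNReal.tsum_le_tsum fun i => ?_
    have h0 := hl0 i
    have h1 := hl1 i
    rw [← ENNReal.ofReal_mul hσ0.le, ← ENNReal.ofReal_add (by positivity) (by positivity),
      ← ENNReal.ofReal_add (by split_ifs <;> linarith) h0]
    apply ENNReal.ofReal_le_ofReal
    split_ifs with hi
    · nlinarith
    · rw [hmem, not_lt] at hi
      nlinarith

/-- Each of `N` orthonormal almost fixed vectors contributes at least `(1 - √ε)²` to the
squared Hilbert–Schmidt norm of `P`. -/
theorem card_mul_le_hsNormSq (P : H →L[ℂ] H) {ε : ℝ} (hε1 : ε < 1) {N : ℕ}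
    {Φ : Fin N → H} (hΦ : Orthonormal ℂ Φ) (h : ∀ j, ‖P (Φ j) - Φ j‖ ^ 2 ≤ ε) :
    N * ENNReal.ofReal ((1 - Real.sqrt ε) ^ 2) ≤ hsNormSq b P := by
  have hsq : Real.sqrt ε < 1 := by
    rw [Real.sqrt_lt' one_pos]; simpa using hε1
  have h1 : ∀ j, ENNReal.ofReal ((1 - Real.sqrt ε) ^ 2) ≤ ‖P (Φ j)‖ₑ ^ 2 := by
    intro j
    rw [← ofReal_norm, ← ENNReal.ofReal_pow (norm_nonneg _)]
    apply ENNReal.ofReal_le_ofReal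
    have h2 : ‖P (Φ j) - Φ j‖ ≤ Real.sqrt ε := Real.le_sqrt_of_sq_le (h j)
    have h3 := norm_sub_norm_le (Φ j) (P (Φ j))
    rw [norm_sub_rev, hΦ.1 j] at h3
    exact pow_le_pow_left₀ (by linarith) (by linarith) 2
  calc (N : ℝ≥0∞) * ENNReal.ofReal ((1 - Real.sqrt ε) ^ 2)
      = ∑ _j : Fin N, ENNReal.ofReal ((1 - Real.sqrt ε) ^ 2) := by simp
    _ ≤ ∑ j, ‖P (Φ j)‖ₑ ^ 2 := Finset.sum_le_sum fun j _ => h1 j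
    _ = ∑ j, ∑' i, ‖inner ℂ (b i) (P (Φ j))‖ₑ ^ 2 := by
        simp only [enorm_sq_eq_tsum_inner b (P _)]
    _ = ∑' i, ∑ j, ‖inner ℂ (b i) (P (Φ j))‖ₑ ^ 2 :=
        (Summable.tsum_finsetSum fun _ _ => ENNReal.summable).symm
    _ ≤ ∑' i, ‖ContinuousLinearMap.adjoint P (b i)‖ₑ ^ 2 := by
        refine ENNReal.tsum_le_tsum fun i => ?_
        have h4 := hΦ.sum_inner_products_le (ContinuousLinearMap.adjoint P (b i))
          (s := Finset.univ)
        have h5 := ENNReal.ofReal_le_ofReal h4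
        rw [ENNReal.ofReal_sum_of_nonneg (fun _ _ => by positivity),
          ENNReal.ofReal_pow (norm_nonneg _), ofReal_norm] at h5
        refine le_trans (le_of_eq (Finset.sum_congr rfl fun j _ => ?_)) h5
        rw [ENNReal.ofReal_pow (norm_nonneg _), ofReal_norm,
          ← ContinuousLinearMap.adjoint_inner_left, ← inner_conj_symm, RCLike.enorm_conj]
    _ = hsNormSq b P := hsNormSq_adjoint b P

end HilbertSchmidt

/-! ### The time- and band-limiting operators as explicit operators -/

section L2

variable {d : ℕ}

theorem L2.enorm_sq_eq_lintegral (f : L2 d) : ‖f‖ₑ ^ 2 = ∫⁻ x, ‖f x‖ₑ ^ 2 := by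
  rw [Lp.enorm_def, eLpNorm_eq_lintegral_rpow_enorm_toReal (by norm_num) (by norm_num),
    ← ENNReal.rpow_natCast, ← ENNReal.rpow_mul]
  simp

theorem timeProj_ae {S : Set (EuclideanSpace ℝ (Fin d))} (hS : MeasurableSet S) (f : L2 d) :
    timeProj S f =ᵐ[volume] S.indicator f := by
  have hmem : MemLp (S.indicator f) 2 volume := (Lp.memLp f).indicator hS
  have h : timeProj S f = hmem.toLp _ := by
    apply Submodule.eq_starProjection_of_mem_of_inner_eq_zero
    · change ∀ᵐ x, x ∉ S → (hmem.toLp _ : L2 d) x = 0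
      filter_upwards [hmem.coeFn_toLp] with x hx hxS
      rw [hx, Set.indicator_of_notMem hxS]
    · intro w hw
      have hw' : ∀ᵐ x, x ∉ S → w x = 0 := hw
      rw [MeasureTheory.L2.inner_def]
      apply integral_eq_zero_of_ae
      filter_upwards [hw', hmem.coeFn_toLp, Lp.coeFn_sub f (hmem.toLp _)] with x h1 h2 h3
      rw [h3, Pi.sub_apply, h2]
      by_cases hx : x ∈ S
      · simp [hx]
      · simp [h1 hx]
  rw [h]
  exact hmem.coeFn_toLp

theorem enorm_timeProj_sq {S : Set (EuclideanSpace ℝ (Fin d))} (hS : MeasurableSet S) (f : L2 d) :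
    ‖timeProj S f‖ₑ ^ 2 = ∫⁻ x in S, ‖f x‖ₑ ^ 2 := by
  rw [L2.enorm_sq_eq_lintegral, ← lintegral_indicator hS]
  refine lintegral_congr_ae ?_
  filter_upwards [timeProj_ae hS f] with x hx
  rw [hx]
  by_cases h : x ∈ S <;> simp [h]

theorem isSelfAdjoint_timeProj (S : Set (EuclideanSpace ℝ (Fin d))) :
    ContinuousLinearMap.adjoint (timeProj S) = timeProj S :=
  (isSelfAdjoint_starProjection (timeLimited S)).adjoint_eq

/-- The Fourier transform on `L²`, as a continuous linear map. -/
def fourierL2 (d : ℕ) : L2 d →L[ℂ] L2 d :=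
  (Lp.fourierTransformₗᵢ (EuclideanSpace ℝ (Fin d)) ℂ).toContinuousLinearEquiv

/-- The inverse Fourier transform on `L²`, as a continuous linear map. -/
def fourierInvL2 (d : ℕ) : L2 d →L[ℂ] L2 d :=
  (Lp.fourierTransformₗᵢ (EuclideanSpace ℝ (Fin d)) ℂ).symm.toContinuousLinearEquiv

theorem adjoint_fourierL2 : ContinuousLinearMap.adjoint (fourierL2 d) = fourierInvL2 d :=
  (Lp.fourierTransformₗᵢ (EuclideanSpace ℝ (Fin d)) ℂ).adjoint_eq_symm

/-- The frequencies of functions band-limited to `Ω`, in Mathlib's normalization of the Fourier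
transform. -/
def freqSet (Ω : Set (EuclideanSpace ℝ (Fin d))) : Set (EuclideanSpace ℝ (Fin d)) :=
  (2 * Real.pi)⁻¹ • Ω

theorem mem_bandLimited_iff (Ω : Set (EuclideanSpace ℝ (Fin d))) (f : L2 d) :
    f ∈ bandLimited Ω ↔ (𝓕 f : L2 d) ∈ timeLimited (freqSet Ω) := by
  have hpi : (2 * Real.pi) ≠ 0 := by positivity
  have h1 : f ∈ bandLimited Ω ↔ ∀ᵐ ξ, ξ ∉ Ω → angularFourier f ξ = 0 := Iff.rfl
  have h2 : (𝓕 f : L2 d) ∈ timeLimited (freqSet Ω) ↔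
      ∀ᵐ x, x ∉ freqSet Ω → (𝓕 f : L2 d) x = 0 := Iff.rfl
  rw [h1, h2]
  simp only [angularFourier_eq_zero_iff]
  have hmem : ∀ x, x ∈ freqSet Ω ↔ (2 * Real.pi) • x ∈ Ω := fun x => by
    rw [freqSet, Set.mem_smul_set_iff_inv_smul_mem₀ (inv_ne_zero hpi), inv_inv]
  have hq : Measure.QuasiMeasurePreserving
      (fun x : EuclideanSpace ℝ (Fin d) => (2 * Real.pi) • x) volume volume := by
    refine ⟨measurable_const_smul _, ?_⟩
    rw [Measure.map_addHaar_smul _ hpi]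
    exact Measure.smul_absolutelyContinuous
  constructor
  · intro h
    filter_upwards [hq.ae h] with x hx hxS
    rw [hmem] at hxS
    have h := hx hxS
    rwa [smul_smul, inv_mul_cancel₀ hpi, one_smul] at h
  · intro h
    filter_upwards [(quasiMeasurePreserving_scale d).ae h] with x hx hxS
    refine hx ?_
    rw [hmem, smul_smul, mul_inv_cancel₀ hpi, one_smul]
    exact hxS

theorem bandProj_eq (Ω : Set (EuclideanSpace ℝ (Fin d))) :
    bandProj Ω = fourierInvL2 d ∘L timeProj (freqSet Ω) ∘L fourierL2 d := by
  ext1 f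
  apply Submodule.eq_starProjection_of_mem_of_inner_eq_zero
  · rw [mem_bandLimited_iff]
    have h : (𝓕 ((fourierInvL2 d ∘L timeProj (freqSet Ω) ∘L fourierL2 d) f) : L2 d) =
        timeProj (freqSet Ω) (fourierL2 d f) :=
      (Lp.fourierTransformₗᵢ (EuclideanSpace ℝ (Fin d)) ℂ).apply_symm_apply _
    rw [h]
    exact Submodule.starProjection_apply_mem _ _
  · intro w hw
    rw [mem_bandLimited_iff] at hw
    rw [← Lp.inner_fourier_eq]
    have h : (𝓕 (f - (fourierInvL2 d ∘L timeProj (freqSet Ω) ∘L fourierL2 d) f) : L2 d) =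
        fourierL2 d f - timeProj (freqSet Ω) (fourierL2 d f) := by
      change fourierL2 d _ = _
      rw [map_sub]
      congr 1
      exact (Lp.fourierTransformₗᵢ (EuclideanSpace ℝ (Fin d)) ℂ).apply_symm_apply _
    rw [h]
    exact Submodule.starProjection_inner_eq_zero _ _ hw

/-- The operator `D_W 𝓕 D_E`, whose modulus squared is the time- and band-limiting operator. -/
def timeBandOp (E W : Set (EuclideanSpace ℝ (Fin d))) : L2 d →L[ℂ] L2 d :=
  timeProj W ∘L fourierL2 d ∘L timeProj E

theorem adjoint_timeBandOp (E W : Set (EuclideanSpace ℝ (Fin d))) :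
    ContinuousLinearMap.adjoint (timeBandOp E W) =
      timeProj E ∘L fourierInvL2 d ∘L timeProj W := by
  simp only [timeBandOp, ContinuousLinearMap.adjoint_comp, isSelfAdjoint_timeProj,
    adjoint_fourierL2]
  rfl

theorem timeProj_timeProj (S : Set (EuclideanSpace ℝ (Fin d))) (f : L2 d) :
    timeProj S (timeProj S f) = timeProj S f :=
  Submodule.starProjection_eq_self_iff.2 (Submodule.starProjection_apply_mem _ _)

theorem limitingOp_eq (E Ω : Set (EuclideanSpace ℝ (Fin d))) :
    limitingOp E Ω = ContinuousLinearMap.adjoint (timeBandOp E (freqSet Ω)) ∘L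
      timeBandOp E (freqSet Ω) := by
  rw [adjoint_timeBandOp, limitingOp, bandProj_eq]
  ext1 f
  simp [timeBandOp, timeProj_timeProj]

theorem norm_timeProj_le (S : Set (EuclideanSpace ℝ (Fin d))) : ‖timeProj S‖ ≤ 1 :=
  Submodule.starProjection_norm_le _

theorem norm_timeBandOp_le (E W : Set (EuclideanSpace ℝ (Fin d))) : ‖timeBandOp E W‖ ≤ 1 := by
  refine ContinuousLinearMap.opNorm_le_bound _ zero_le_one fun f => ?_
  calc ‖timeProj W (fourierL2 d (timeProj E f))‖
      ≤ 1 * ‖fourierL2 d (timeProj E f)‖ := (timeProj W).le_of_opNorm_le (norm_timeProj_le W) _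
    _ = ‖timeProj E f‖ := by
        rw [one_mul]
        exact (Lp.fourierTransformₗᵢ (EuclideanSpace ℝ (Fin d)) ℂ).norm_map _
    _ ≤ 1 * ‖f‖ := (timeProj E).le_of_opNorm_le (norm_timeProj_le E) _

theorem isSymmetric_limitingOp (E Ω : Set (EuclideanSpace ℝ (Fin d))) :
    (limitingOp E Ω).IsSymmetric := by
  intro x y
  change inner ℂ (limitingOp E Ω x) y = inner ℂ x (limitingOp E Ω y)
  rw [limitingOp_eq, ContinuousLinearMap.comp_apply, ContinuousLinearMap.comp_apply,
    ContinuousLinearMap.adjoint_inner_left, ContinuousLinearMap.adjoint_inner_right]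

theorem norm_limitingOp_le (E Ω : Set (EuclideanSpace ℝ (Fin d))) : ‖limitingOp E Ω‖ ≤ 1 := by
  rw [limitingOp_eq]
  refine (ContinuousLinearMap.opNorm_comp_le _ _).trans ?_
  rw [LinearIsometryEquiv.norm_map]
  exact mul_le_one₀ (norm_timeBandOp_le _ _) (norm_nonneg _) (norm_timeBandOp_le _ _)

end L2

/-! ### The inverse Fourier transform on integrable square-integrable functions -/

section Fourier

variable {d : ℕ}

theorem continuous_fourierInv_of_integrable {f : EuclideanSpace ℝ (Fin d) → ℂ}
    (hf : Integrable f) : Continuous (𝓕⁻ f) := by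
  have h := VectorFourier.fourierIntegral_continuous (L := innerₗ (EuclideanSpace ℝ (Fin d)))
    Real.continuous_fourierChar continuous_inner hf
  have h2 : 𝓕⁻ f = fun w => 𝓕 f (-w) := funext fun w => Real.fourierInv_eq_fourier_neg f w
  rw [h2]
  exact h.comp continuous_neg

/-- On integrable functions the `L²` inverse Fourier transform is given by the integral: both agree
when they are tested against Schwartz functions. -/
theorem fourierInvL2_ae {h : L2 d} (hint : Integrable h volume) :
    (fourierInvL2 d h : L2 d) =ᵐ[volume] 𝓕⁻ (h : EuclideanSpace ℝ (Fin d) → ℂ) := by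
  apply ae_eq_of_integral_contDiff_smul_eq
  · exact (Lp.memLp (fourierInvL2 d h)).locallyIntegrable (by norm_num)
  · exact (continuous_fourierInv_of_integrable hint).locallyIntegrable
  · intro g g_smooth g_cpt
    have hg₁ : HasCompactSupport (Complex.ofRealCLM ∘ g) := g_cpt.comp_left rfl
    have hg₂ : ContDiff ℝ (⊤ : ℕ∞) (Complex.ofRealCLM ∘ g) :=
      Complex.ofRealCLM.contDiff.comp g_smooth
    set G := hg₁.toSchwartzMap hg₂ with hG
    have hGg : ∀ x, G x = (g x : ℂ) := fun x => by simp [hG]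
    have h1 : ∫ x, g x • (fourierInvL2 d h : L2 d) x =
        Lp.toTemperedDistribution (fourierInvL2 d h) G := by
      rw [Lp.toTemperedDistribution_apply]
      simp [hGg]
    have h2 : Lp.toTemperedDistribution (fourierInvL2 d h) =
        𝓕⁻ (Lp.toTemperedDistribution h) :=
      (Lp.fourierInv_toTemperedDistribution_eq h).symm
    have h3 := VectorFourier.integral_fourierIntegral_smul_eq_flip
      (L := -innerₗ (EuclideanSpace ℝ (Fin d))) (μ := volume) (ν := volume)
      Real.continuous_fourierChar (by
        have : Continuous fun p : EuclideanSpace ℝ (Fin d) × EuclideanSpace ℝ (Fin d) =>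
          -(inner ℝ p.1 p.2) := continuous_inner.neg
        exact this) G.integrable hint
    have h4 : (-innerₗ (EuclideanSpace ℝ (Fin d))).flip = -innerₗ (EuclideanSpace ℝ (Fin d)) := by
      ext x y
      simp [real_inner_comm]
    rw [h4] at h3
    rw [h1, h2, TemperedDistribution.fourierInv_apply, Lp.toTemperedDistribution_apply,
      SchwartzMap.fourierInv_coe]
    refine Eq.trans h3 ?_
    simp only [hGg]
    rfl

end Fourier

/-! ### Hilbert–Schmidt norms of the time- and band-limiting operators -/

section Kernel

variable {d : ℕ} {W : Set (EuclideanSpace ℝ (Fin d))}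

/-- The character `v ↦ exp (-2πi v·x)`, cut off to the set `W`. -/
def cutChar (W : Set (EuclideanSpace ℝ (Fin d))) (x : EuclideanSpace ℝ (Fin d)) :
    EuclideanSpace ℝ (Fin d) → ℂ :=
  W.indicator fun v => (Real.fourierChar (-(inner ℝ v x)) : ℂ)

theorem memLp_cutChar (hW : MeasurableSet W) (hWfin : volume W ≠ ⊤) (p : ℝ≥0∞)
    (x : EuclideanSpace ℝ (Fin d)) : MemLp (cutChar W x) p volume := by
  refine (memLp_indicator_const p hW (1 : ℂ) (Or.inr hWfin)).of_le ?_ (ae_of_all _ fun v => ?_)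
  · refine AEStronglyMeasurable.indicator ?_ hW
    refine Continuous.aestronglyMeasurable ?_
    exact continuous_subtype_val.comp (Real.continuous_fourierChar.comp (by fun_prop))
  · by_cases h : v ∈ W
    · simp [cutChar, h, Circle.norm_coe]
    · simp [cutChar, h]

/-- The cut-off character as an element of `L²`. -/
def charVec (hW : MeasurableSet W) (hWfin : volume W ≠ ⊤) (x : EuclideanSpace ℝ (Fin d)) : L2 d :=
  (memLp_cutChar hW hWfin 2 x).toLp _

theorem charVec_ae (hW : MeasurableSet W) (hWfin : volume W ≠ ⊤)
    (x : EuclideanSpace ℝ (Fin d)) : charVec hW hWfin x =ᵐ[volume] cutChar W x :=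
  (memLp_cutChar hW hWfin 2 x).coeFn_toLp

/-- The cut-off characters have constant norm, since characters have modulus one. -/
theorem enorm_charVec_sq (hW : MeasurableSet W) (hWfin : volume W ≠ ⊤)
    (x : EuclideanSpace ℝ (Fin d)) : ‖charVec hW hWfin x‖ₑ ^ 2 = volume W := by
  rw [L2.enorm_sq_eq_lintegral]
  have h : ∫⁻ v, ‖charVec hW hWfin x v‖ₑ ^ 2 = ∫⁻ v, W.indicator (fun _ => 1) v := by
    refine lintegral_congr_ae ?_
    filter_upwards [charVec_ae hW hWfin x] with v hv
    rw [hv]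
    by_cases h : v ∈ W
    · simp [cutChar, h, ← ofReal_norm, Circle.norm_coe]
    · simp [cutChar, h]
  rw [h, lintegral_indicator hW]
  simp

theorem integrable_timeProj (hW : MeasurableSet W) (hWfin : volume W ≠ ⊤) (h : L2 d) :
    Integrable (timeProj W h) volume := by
  have h1 : Integrable (W.indicator h) volume := by
    rw [integrable_indicator_iff hW]
    have : IsFiniteMeasure (volume.restrict W) := ⟨by simpa using hWfin.lt_top⟩
    exact ((Lp.memLp h).restrict W).integrable (by norm_num)
  exact h1.congr (timeProj_ae hW h).symm

/-- Reconstruction of a band-limited function from its Fourier transform, pointwise. -/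
theorem fourierInvL2_timeProj_ae (hW : MeasurableSet W) (hWfin : volume W ≠ ⊤) (h : L2 d) :
    ∀ᵐ x, (fourierInvL2 d (timeProj W h) : L2 d) x = inner ℂ (charVec hW hWfin x) h := by
  filter_upwards [fourierInvL2_ae (integrable_timeProj hW hWfin h)] with x hx
  rw [hx, Real.fourierInv_eq, MeasureTheory.L2.inner_def]
  refine integral_congr_ae ?_
  filter_upwards [timeProj_ae hW h, charVec_ae hW hWfin x] with v h1 h2
  rw [h1, h2]
  by_cases hv : v ∈ W
  · simp only [cutChar, hv, Set.indicator_of_mem, RCLike.inner_apply, Circle.smul_def,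
      smul_eq_mul]
    rw [mul_comm, ← Circle.coe_inv_eq_conj, AddChar.map_neg_eq_inv, inv_inv]
  · simp [cutChar, hv]

/-- An operator `B C`, where `B = D_E 𝓕⁻¹ D_W` has the kernel `(x, v) ↦ 1_E(x) 1_W(v) exp(2πi v·x)`,
has a Hilbert–Schmidt norm that can be computed by letting `C†` act on the rows of the kernel. -/
theorem hsNormSq_comp {E : Set (EuclideanSpace ℝ (Fin d))} (hE : MeasurableSet E)
    (hW : MeasurableSet W) (hWfin : volume W ≠ ⊤) {ι : Type*} (b : HilbertBasis ι ℂ (L2 d))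
    (C : L2 d →L[ℂ] L2 d) :
    hsNormSq b (ContinuousLinearMap.adjoint (timeBandOp E W) ∘L C) =
      ∫⁻ x in E, ‖ContinuousLinearMap.adjoint C (charVec hW hWfin x)‖ₑ ^ 2 := by
  have : Fact ((2 : ℝ≥0∞) ≠ ⊤) := ⟨by norm_num⟩
  have hcount : Countable ι := countable_hilbertBasis b
  have h1 : ∀ i, ‖(ContinuousLinearMap.adjoint (timeBandOp E W) ∘L C) (b i)‖ₑ ^ 2 =
      ∫⁻ x in E, ‖(fourierInvL2 d (timeProj W (C (b i))) : L2 d) x‖ₑ ^ 2 := by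
    intro i
    rw [adjoint_timeBandOp]
    exact enorm_timeProj_sq hE _
  simp only [hsNormSq, h1]
  rw [← lintegral_tsum]
  · refine lintegral_congr_ae (ae_restrict_of_ae ?_)
    filter_upwards [ae_all_iff.2 fun i => fourierInvL2_timeProj_ae hW hWfin (C (b i))] with x hx
    simp only [hx]
    rw [enorm_sq_eq_tsum_inner b]
    refine tsum_congr fun i => ?_
    rw [ContinuousLinearMap.adjoint_inner_right, ← inner_conj_symm, RCLike.enorm_conj]
  · intro i
    exact ((Lp.aestronglyMeasurable _).enorm.pow_const 2).restrict

theorem hsNormSq_timeBandOp {E : Set (EuclideanSpace ℝ (Fin d))} (hE : MeasurableSet E)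
    (hW : MeasurableSet W) (hWfin : volume W ≠ ⊤) {ι : Type*} (b : HilbertBasis ι ℂ (L2 d)) :
    hsNormSq b (timeBandOp E W) = volume W * volume E := by
  have h := hsNormSq_comp hE hW hWfin b (ContinuousLinearMap.id ℂ (L2 d))
  rw [ContinuousLinearMap.comp_id, hsNormSq_adjoint] at h
  rw [h, ContinuousLinearMap.adjoint_id]
  simp [enorm_charVec_sq]

/-- The convolution kernel of the projection onto the functions with frequencies in `W`. -/
def bandKernel (W : Set (EuclideanSpace ℝ (Fin d))) : EuclideanSpace ℝ (Fin d) → ℂ :=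
  𝓕⁻ (W.indicator fun _ => (1 : ℂ))

theorem continuous_bandKernel (hW : MeasurableSet W) (hWfin : volume W ≠ ⊤) :
    Continuous (bandKernel W) :=
  continuous_fourierInv_of_integrable
    ((integrable_indicator_iff hW).2 (integrableOn_const hWfin))

/-- Modulation becomes translation: the rows of the reproducing kernel are translates of
`bandKernel W`. -/
theorem fourierInvL2_charVec_ae (hW : MeasurableSet W) (hWfin : volume W ≠ ⊤)
    (x : EuclideanSpace ℝ (Fin d)) :
    ∀ᵐ y, (fourierInvL2 d (charVec hW hWfin x) : L2 d) y = bandKernel W (y - x) := by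
  have hint : Integrable (charVec hW hWfin x) volume :=
    (memLp_one_iff_integrable.1 (memLp_cutChar hW hWfin 1 x)).congr (charVec_ae hW hWfin x).symm
  filter_upwards [fourierInvL2_ae hint] with y hy
  rw [hy, Real.fourierInv_congr_ae (charVec_ae hW hWfin x), bandKernel, Real.fourierInv_eq,
    Real.fourierInv_eq]
  refine integral_congr_ae (ae_of_all _ fun v => ?_)
  by_cases hv : v ∈ W
  · simp only [cutChar, hv, Set.indicator_of_mem, Circle.smul_def, smul_eq_mul, mul_one]
    rw [inner_sub_right, sub_eq_add_neg, AddChar.map_add_eq_mul, Circle.coe_mul]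
  · simp [cutChar, hv]

theorem lintegral_bandKernel_sq (hW : MeasurableSet W) (hWfin : volume W ≠ ⊤) :
    ∫⁻ u, ‖bandKernel W u‖ₑ ^ 2 = volume W := by
  rw [← enorm_charVec_sq hW hWfin 0]
  have h : ‖charVec hW hWfin 0‖ₑ = ‖fourierInvL2 d (charVec hW hWfin 0)‖ₑ :=
    ((Lp.fourierTransformₗᵢ (EuclideanSpace ℝ (Fin d)) ℂ).symm.enorm_map _).symm
  rw [h, L2.enorm_sq_eq_lintegral]
  refine lintegral_congr_ae ?_
  filter_upwards [fourierInvL2_charVec_ae hW hWfin 0] with y hy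
  rw [hy, sub_zero]

theorem timeProj_charVec (hW : MeasurableSet W) (hWfin : volume W ≠ ⊤)
    (x : EuclideanSpace ℝ (Fin d)) : timeProj W (charVec hW hWfin x) = charVec hW hWfin x := by
  apply Lp.ext
  filter_upwards [timeProj_ae hW (charVec hW hWfin x), charVec_ae hW hWfin x] with v h1 h2
  rw [h1]
  by_cases hv : v ∈ W
  · rw [Set.indicator_of_mem hv]
  · rw [Set.indicator_of_notMem hv, h2, cutChar, Set.indicator_of_notMem hv]

/-- The squared Hilbert–Schmidt norm of `D_E B_W D_E` is the integral of the squared convolution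
kernel over `E × E`. -/
theorem hsNormSq_adjoint_comp_timeBandOp {E : Set (EuclideanSpace ℝ (Fin d))}
    (hE : MeasurableSet E) (hW : MeasurableSet W) (hWfin : volume W ≠ ⊤)
    {ι : Type*} (b : HilbertBasis ι ℂ (L2 d)) :
    hsNormSq b (ContinuousLinearMap.adjoint (timeBandOp E W) ∘L timeBandOp E W) =
      ∫⁻ x in E, ∫⁻ y in E, ‖bandKernel W (y - x)‖ₑ ^ 2 := by
  rw [hsNormSq_comp hE hW hWfin]
  refine lintegral_congr fun x => ?_
  have h : ContinuousLinearMap.adjoint (timeBandOp E W) (charVec hW hWfin x) =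
      timeProj E (fourierInvL2 d (charVec hW hWfin x)) := by
    rw [adjoint_timeBandOp]
    simp [timeProj_charVec]
  rw [h, enorm_timeProj_sq hE]
  refine lintegral_congr_ae (ae_restrict_of_ae ?_)
  filter_upwards [fourierInvL2_charVec_ae hW hWfin x] with y hy
  rw [hy]

/-- The mass of the kernel that leaves `E`; it is the difference of the squared Hilbert–Schmidt
norms of `D_W 𝓕 D_E` and `D_E B_W D_E`. -/
def leakage (E W : Set (EuclideanSpace ℝ (Fin d))) : ℝ≥0∞ :=
  ∫⁻ u, ‖bandKernel W u‖ₑ ^ 2 * volume (E ∩ {x | x + u ∉ E})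

theorem lintegral_add_leakage {E : Set (EuclideanSpace ℝ (Fin d))}
    (hE : MeasurableSet E) (hW : MeasurableSet W)
    (hWfin : volume W ≠ ⊤) :
    (∫⁻ x in E, ∫⁻ y in E, ‖bandKernel W (y - x)‖ₑ ^ 2) + leakage E W =
      volume W * volume E := by
  have hK : Measurable fun u => ‖bandKernel W u‖ₑ ^ 2 :=
    (continuous_bandKernel hW hWfin).measurable.enorm.pow_const 2
  have hcompl : ∫⁻ x in E, ∫⁻ y in Eᶜ, ‖bandKernel W (y - x)‖ₑ ^ 2 = leakage E W := by
    have h1 : ∀ x, ∫⁻ y in Eᶜ, ‖bandKernel W (y - x)‖ₑ ^ 2 =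
        ∫⁻ u, ‖bandKernel W u‖ₑ ^ 2 * Eᶜ.indicator 1 (x + u) := by
      intro x
      rw [← lintegral_indicator hE.compl, ← lintegral_add_left_eq_self _ x]
      refine lintegral_congr fun u => ?_
      by_cases h : x + u ∈ Eᶜ <;> simp [h]
    simp only [h1]
    have hmeas : Measurable fun p : EuclideanSpace ℝ (Fin d) × EuclideanSpace ℝ (Fin d) =>
        ‖bandKernel W p.2‖ₑ ^ 2 * Eᶜ.indicator (1 : EuclideanSpace ℝ (Fin d) → ℝ≥0∞) (p.1 + p.2) :=
      (hK.comp measurable_snd).mul ((measurable_one.indicator hE.compl).comp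
        (measurable_fst.add measurable_snd))
    rw [lintegral_lintegral_swap hmeas.aemeasurable, leakage]
    refine lintegral_congr fun u => ?_
    have hmu : Measurable fun x : EuclideanSpace ℝ (Fin d) =>
        Eᶜ.indicator (1 : EuclideanSpace ℝ (Fin d) → ℝ≥0∞) (x + u) :=
      (measurable_one.indicator hE.compl).comp (measurable_id.add_const u)
    rw [lintegral_const_mul _ hmu]
    congr 1
    have hset : MeasurableSet {x : EuclideanSpace ℝ (Fin d) | x + u ∉ E} :=
      (measurable_id.add_const u) hE.compl
    have h2 : (fun x => Eᶜ.indicator (1 : EuclideanSpace ℝ (Fin d) → ℝ≥0∞) (x + u)) =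
        {x : EuclideanSpace ℝ (Fin d) | x + u ∉ E}.indicator 1 := by
      funext x
      by_cases h : x + u ∈ E <;> simp [h]
    rw [h2, lintegral_indicator_one hset, Measure.restrict_apply hset, Set.inter_comm]
  have hmeas2 : Measurable fun p : EuclideanSpace ℝ (Fin d) × EuclideanSpace ℝ (Fin d) =>
      ‖bandKernel W (p.2 - p.1)‖ₑ ^ 2 := hK.comp (measurable_snd.sub measurable_fst)
  rw [← hcompl, ← lintegral_add_left hmeas2.lintegral_prod_right']
  have h3 : ∀ x, (∫⁻ y in E, ‖bandKernel W (y - x)‖ₑ ^ 2) +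
      ∫⁻ y in Eᶜ, ‖bandKernel W (y - x)‖ₑ ^ 2 = volume W := by
    intro x
    rw [lintegral_add_compl _ hE,
      lintegral_sub_right_eq_self (fun u => ‖bandKernel W u‖ₑ ^ 2) x,
      lintegral_bandKernel_sq hW hWfin]
  simp only [h3]
  simp

end Kernel

/-! ### Dilations of the time domain -/

section Dilation

variable {d : ℕ} {T W : Set (EuclideanSpace ℝ (Fin d))}

theorem tendsto_volume_inter_translate (hT : MeasurableSet T) (hTfin : volume T ≠ ⊤) :
    Tendsto (fun v : EuclideanSpace ℝ (Fin d) => volume (T ∩ {x | x + v ∉ T})) (𝓝 0) (𝓝 0) := by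
  let f : EuclideanSpace ℝ (Fin d) → C(EuclideanSpace ℝ (Fin d), EuclideanSpace ℝ (Fin d)) :=
    fun v => ⟨fun x => x + v, by fun_prop⟩
  have hf : Continuous f := ContinuousMap.continuous_of_continuous_uncurry _ (by
    change Continuous fun p : EuclideanSpace ℝ (Fin d) × EuclideanSpace ℝ (Fin d) => p.2 + p.1
    fun_prop)
  have h := tendsto_measure_symmDiff_preimage_nhds_zero (μ := volume) (ν := volume)
    (hf.tendsto 0) (Eventually.of_forall fun v => measurePreserving_add_right volume v)
    (measurePreserving_add_right volume 0) hT.nullMeasurableSet hTfin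
  refine tendsto_of_tendsto_of_tendsto_of_le_of_le tendsto_const_nhds h (fun _ => zero_le) ?_
  intro v
  refine measure_mono fun x hx => Or.inr ⟨?_, hx.2⟩
  change x + 0 ∈ T
  simpa using hx.1

/-- The part of `r • T` that a translation by `u` moves out of it is the dilation of the part of `T`
that a translation by `u / r` moves out of `T`. -/
theorem leakage_smul {r : ℝ} (hr : 0 < r) :
    leakage (r • T) W = ENNReal.ofReal (r ^ d) *
      ∫⁻ u, ‖bandKernel W u‖ₑ ^ 2 * volume (T ∩ {x | x + r⁻¹ • u ∉ T}) := by
  have hset : ∀ u : EuclideanSpace ℝ (Fin d),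
      r • T ∩ {x | x + u ∉ r • T} = r • (T ∩ {x | x + r⁻¹ • u ∉ T}) := by
    intro u
    ext x
    simp only [Set.mem_inter_iff, Set.mem_smul_set_iff_inv_smul_mem₀ hr.ne', Set.mem_ofPred_eq,
      smul_add]
  simp only [leakage, hset, Measure.addHaar_smul, finrank_euclideanSpace_fin,
    abs_of_pos (pow_pos hr d)]
  rw [← lintegral_const_mul' _ _ ENNReal.ofReal_ne_top]
  refine lintegral_congr fun u => ?_
  ring

/-- The leakage out of `r • T` is of lower order than `r ^ d`. -/
theorem tendsto_lintegral_bandKernel (hT : MeasurableSet T) (hTfin : volume T ≠ ⊤)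
    (hW : MeasurableSet W) (hWfin : volume W ≠ ⊤) :
    Tendsto (fun r : ℝ => ∫⁻ u, ‖bandKernel W u‖ₑ ^ 2 * volume (T ∩ {x | x + r⁻¹ • u ∉ T}))
      atTop (𝓝 0) := by
  have hK : Measurable fun u => ‖bandKernel W u‖ₑ ^ 2 :=
    (continuous_bandKernel hW hWfin).measurable.enorm.pow_const 2
  have h := tendsto_lintegral_filter_of_dominated_convergence (μ := volume) (l := atTop)
    (F := fun (r : ℝ) u => ‖bandKernel W u‖ₑ ^ 2 * volume (T ∩ {x | x + r⁻¹ • u ∉ T}))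
    (f := fun _ => 0) (fun u => ‖bandKernel W u‖ₑ ^ 2 * volume T) ?_ ?_ ?_ ?_
  · simpa using h
  · refine Eventually.of_forall fun r => hK.mul ?_
    have hm : MeasurableSet {p : EuclideanSpace ℝ (Fin d) × EuclideanSpace ℝ (Fin d) |
        p.2 ∈ T ∧ p.2 + r⁻¹ • p.1 ∉ T} :=
      (measurable_snd hT).inter ((measurable_snd.add (measurable_fst.const_smul r⁻¹)) hT.compl)
    exact measurable_measure_prodMk_left hm
  · refine Eventually.of_forall fun r => ae_of_all _ fun u => ?_
    gcongr
    exact Set.inter_subset_left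
  · rw [lintegral_mul_const _ hK, lintegral_bandKernel_sq hW hWfin]
    exact ENNReal.mul_ne_top hWfin hTfin
  · refine ae_of_all _ fun u => ?_
    have h1 : Tendsto (fun r : ℝ => r⁻¹ • u) atTop (𝓝 0) := by
      have h := (tendsto_inv_atTop_zero (𝕜 := ℝ)).smul_const u
      rwa [zero_smul] at h
    have h2 := (tendsto_volume_inter_translate hT hTfin).comp h1
    have h3 := ENNReal.Tendsto.const_mul (a := ‖bandKernel W u‖ₑ ^ 2) h2
      (Or.inr (by simp))
    rwa [mul_zero] at h3

end Dilation

/-! ### Existence of the data -/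

section Existence

variable {d : ℕ}

/-- There are arbitrarily many orthonormal functions supported outside a set of finite measure. -/
theorem exists_orthonormal_ker (hd : 0 < d) {E Ω : Set (EuclideanSpace ℝ (Fin d))}
    (hE : MeasurableSet E) (hEfin : volume E ≠ ⊤) (m : ℕ) :
    ∃ h : Fin m → L2 d, Orthonormal ℂ h ∧ ∀ i, limitingOp E Ω (h i) = 0 := by
  have : Nonempty (Fin d) := ⟨⟨0, hd⟩⟩
  have : NoncompactSpace (EuclideanSpace ℝ (Fin d)) := NormedSpace.noncompactSpace ℝ _
  -- The complement of `E` has infinite measure, so infinitely many pieces of a countable partition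
  -- of it into sets of finite measure are not null; the functions are their normalized indicators.
  have htop : volume Eᶜ = ⊤ := by
    rw [measure_compl hE hEfin, measure_univ_of_isAddLeftInvariant, ENNReal.top_sub hEfin]
  set A : ℕ → Set (EuclideanSpace ℝ (Fin d)) :=
    fun k => Eᶜ ∩ disjointed (spanningSets volume) k with hA
  have hAm : ∀ k, MeasurableSet (A k) := fun k =>
    hE.compl.inter (MeasurableSet.disjointed (measurableSet_spanningSets volume) k)
  have hAfin : ∀ k, volume (A k) ≠ ⊤ := fun k =>
    ne_top_of_le_ne_top (measure_spanningSets_lt_top volume k).ne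
      (measure_mono (Set.inter_subset_right.trans (disjointed_subset _ _)))
  have hdisj : Pairwise (Function.onFun Disjoint A) := fun i j hij =>
    ((disjoint_disjointed (spanningSets volume)) hij).mono Set.inter_subset_right
      Set.inter_subset_right
  have hsum : volume Eᶜ = ∑' k, volume (A k) := by
    rw [← measure_iUnion hdisj hAm, hA, ← Set.inter_iUnion, iUnion_disjointed,
      iUnion_spanningSets, Set.inter_univ]
  have hinf : {k | volume (A k) ≠ 0}.Infinite := by
    intro hfin
    rw [htop, tsum_eq_sum (s := hfin.toFinset) (fun k hk => by simpa using hk)] at hsum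
    exact (ENNReal.sum_ne_top.2 fun k _ => hAfin k) hsum.symm
  let e := hinf.natEmbedding
  have hpos : ∀ k, 0 < volume.real (A (e k)) := fun k =>
    ENNReal.toReal_pos (e k).2 (hAfin _)
  refine ⟨fun i => indicatorConstLp 2 (hAm (e i)) (hAfin (e i))
    (((Real.sqrt (volume.real (A (e i))))⁻¹ : ℝ) : ℂ), ?_, ?_⟩
  · rw [orthonormal_iff_ite]
    intro i j
    rw [MeasureTheory.L2.inner_indicatorConstLp_indicatorConstLp (hAm _) (hAm _) (hAfin _)
      (hAfin _)]
    split_ifs with hij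
    · subst hij
      rw [Set.inter_self, RCLike.inner_apply, Complex.conj_ofReal, ← Complex.ofReal_mul,
        ← mul_inv, Real.mul_self_sqrt (hpos i).le, Complex.real_smul, ← Complex.ofReal_mul,
        mul_inv_cancel₀ (hpos i).ne', Complex.ofReal_one]
    · have hne : ((e i : ℕ)) ≠ e j := fun h =>
        hij (Fin.ext (e.injective (Subtype.ext h)))
      rw [(hdisj hne).inter_eq]
      simp
  · intro i
    have h : timeProj E (indicatorConstLp 2 (hAm (e i)) (hAfin (e i))
        (((Real.sqrt (volume.real (A (e i))))⁻¹ : ℝ) : ℂ)) = 0 := by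
      apply Lp.ext
      filter_upwards [timeProj_ae hE (indicatorConstLp 2 (hAm (e i)) (hAfin (e i))
        (((Real.sqrt (volume.real (A (e i))))⁻¹ : ℝ) : ℂ)),
        indicatorConstLp_coeFn (p := 2) (hs := hAm (e i)) (hμs := hAfin (e i))
          (c := (((Real.sqrt (volume.real (A (e i))))⁻¹ : ℝ) : ℂ)),
        Lp.coeFn_zero ℂ 2 (volume : Measure (EuclideanSpace ℝ (Fin d)))] with x h1 h2 h3
      rw [h1, h3]
      by_cases hx : x ∈ E
      · rw [Set.indicator_of_mem hx, h2, Set.indicator_of_notMem (fun h => h.1 hx)]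
        rfl
      · rw [Set.indicator_of_notMem hx]
        rfl
    rw [limitingOp, ContinuousLinearMap.comp_apply, ContinuousLinearMap.comp_apply, h, map_zero,
      map_zero]

theorem hsNormSq_limitingOp_ne_top {E Ω : Set (EuclideanSpace ℝ (Fin d))}
    (hE : MeasurableSet E) (hEfin : volume E ≠ ⊤) (hW : MeasurableSet (freqSet Ω))
    (hWfin : volume (freqSet Ω) ≠ ⊤) {ι : Type*} (b : HilbertBasis ι ℂ (L2 d)) :
    hsNormSq b (limitingOp E Ω) ≠ ⊤ := by
  rw [limitingOp_eq, hsNormSq_adjoint_comp_timeBandOp hE hW hWfin]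
  refine ne_top_of_le_ne_top (ENNReal.mul_ne_top hWfin hEfin) ?_
  rw [← lintegral_add_leakage hE hW hWfin]
  exact le_self_add

/-- The data exist, and the number of eigenvalues above `1 - σ` is at least `|W| |E| - leakage / σ`
(stated after multiplication by `σ`, to avoid subtraction in `ℝ≥0∞`). -/
theorem exists_data (hd : 0 < d) {E Ω : Set (EuclideanSpace ℝ (Fin d))}
    (hE : MeasurableSet E) (hEfin : volume E ≠ ⊤) (hW : MeasurableSet (freqSet Ω))
    (hWfin : volume (freqSet Ω) ≠ ⊤) {σ : ℝ} (hσ0 : 0 < σ) (hσ1 : σ < 1) :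
    ∃ n : ℕ, (∀ m : ℕ, (0 < n ∨ m = 0) → Nonempty (Data (limitingOp E Ω) σ n m)) ∧
      ENNReal.ofReal σ * (volume (freqSet Ω) * volume E) ≤
        ENNReal.ofReal σ * n + leakage E (freqSet Ω) := by
  obtain ⟨_, b, _⟩ := exists_hilbertBasis ℂ (L2 d)
  have hfin : volume (freqSet Ω) * volume E ≠ ⊤ := ENNReal.mul_ne_top hWfin hEfin
  have hA := hsNormSq_timeBandOp hE hW hWfin b
  obtain ⟨n, φ, hφ, hn⟩ := exists_isTopEigensystem b (limitingOp_eq E Ω)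
    (norm_timeBandOp_le _ _) (hA ▸ hfin) hσ0 hσ1
  refine ⟨n, fun m hm => ?_, ?_⟩
  · obtain ⟨h, hh, hker⟩ := exists_orthonormal_ker (Ω := Ω) hd hE hEfin m
    obtain ⟨e, he⟩ := exists_column hm
    exact ⟨⟨φ, hφ, h, hh, hker, e, he⟩⟩
  -- With `∑ λ = ∑ λ² + leakage` on the right-hand side, the finite `∑ λ²` cancels.
  · have hP := hsNormSq_limitingOp_ne_top hE hEfin hW hWfin b
    rw [hA] at hn
    nth_rewrite 2 [← lintegral_add_leakage hE hW hWfin] at hn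
    rw [← hsNormSq_adjoint_comp_timeBandOp hE hW hWfin b, ← limitingOp_eq,
      add_comm (hsNormSq b _) (leakage _ _), ← add_assoc] at hn
    exact (ENNReal.add_le_add_iff_right hP).1 hn

/-- The operators depend only on the sets up to null sets. -/
theorem limitingOp_congr {E E' Ω Ω' : Set (EuclideanSpace ℝ (Fin d))}
    (hE : E =ᵐ[volume] E') (hΩ : Ω =ᵐ[volume] Ω') : limitingOp E Ω = limitingOp E' Ω' := by
  have h1 : timeLimited E = timeLimited E' := by
    ext f
    change (∀ᵐ x, x ∉ E → f x = 0) ↔ ∀ᵐ x, x ∉ E' → f x = 0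
    refine eventually_congr ?_
    filter_upwards [hE.mem_iff] with x hx
    rw [hx]
  have h2 : bandLimited Ω = bandLimited Ω' := by
    ext f
    change (∀ᵐ x, x ∉ Ω → angularFourier f x = 0) ↔ ∀ᵐ x, x ∉ Ω' → angularFourier f x = 0
    refine eventually_congr ?_
    filter_upwards [hΩ.mem_iff] with x hx
    rw [hx]
  simp only [limitingOp, timeProj, bandProj, h1, h2]

theorem smul_ae_eq {T T' : Set (EuclideanSpace ℝ (Fin d))} (h : T =ᵐ[volume] T') {r : ℝ}
    (hr : 0 < r) : (r • T : Set _) =ᵐ[volume] (r • T' : Set _) := by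
  have hq : Measure.QuasiMeasurePreserving
      (fun x : EuclideanSpace ℝ (Fin d) => r⁻¹ • x) volume volume := by
    refine ⟨measurable_const_smul _, ?_⟩
    rw [Measure.map_addHaar_smul _ (inv_ne_zero hr.ne')]
    exact Measure.smul_absolutelyContinuous
  rw [← Set.preimage_smul_inv₀ hr.ne', ← Set.preimage_smul_inv₀ hr.ne']
  exact hq.preimage_ae_eq h

/-- The asymptotic count of eigenvalues: up to an error `r ^ d * L r / σ` with `L r → 0`, at least
`(2π)^(-d) |T| |Ω| r ^ d` eigenvalues exceed `1 - σ`. -/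
theorem exists_data_smul (hd : 0 < d) {T Ω : Set (EuclideanSpace ℝ (Fin d))}
    (hT : NullMeasurableSet T volume) (hΩ : NullMeasurableSet Ω volume)
    (hTfin : volume T < ⊤) (hΩfin : volume Ω < ⊤) :
    (∀ r : ℝ, 0 < r → ∀ {ι : Type} (b : HilbertBasis ι ℂ (L2 d)),
      hsNormSq b (limitingOp (r • T) Ω) ≠ ⊤) ∧
    ∃ L : ℝ → ℝ, (∀ r, 0 ≤ L r) ∧ Tendsto L atTop (𝓝 0) ∧ ∀ r σ : ℝ, 0 < r → 0 < σ → σ < 1 →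
      ∃ n : ℕ, (∀ m : ℕ, (0 < n ∨ m = 0) → Nonempty (Data (limitingOp (r • T) Ω) σ n m)) ∧
        (((2 * Real.pi) ^ d)⁻¹ * volume.real T * volume.real Ω - L r / σ) * r ^ d ≤ n := by
  obtain ⟨T', -, hT', hTT'⟩ := hT.exists_measurable_superset_ae_eq
  obtain ⟨Ω', -, hΩ', hΩΩ'⟩ := hΩ.exists_measurable_superset_ae_eq
  have hpi : (0 : ℝ) < (2 * Real.pi)⁻¹ := by positivity
  have hop : ∀ r : ℝ, 0 < r → limitingOp (r • T) Ω = limitingOp (r • T') Ω' := fun r hr =>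
    limitingOp_congr (smul_ae_eq hTT'.symm hr) hΩΩ'.symm
  have hT'fin : volume T' ≠ ⊤ := by rw [measure_congr hTT']; exact hTfin.ne
  have hvW : volume (freqSet Ω') = ENNReal.ofReal ((2 * Real.pi)⁻¹ ^ d) * volume Ω := by
    rw [freqSet, Measure.addHaar_smul, finrank_euclideanSpace_fin, abs_of_pos (pow_pos hpi d),
      measure_congr hΩΩ']
  have hW : MeasurableSet (freqSet Ω') := hΩ'.const_smul_of_ne_zero hpi.ne'
  have hWfin : volume (freqSet Ω') ≠ ⊤ := by
    rw [hvW]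
    exact ENNReal.mul_ne_top ENNReal.ofReal_ne_top hΩfin.ne
  have hE : ∀ r : ℝ, 0 < r → MeasurableSet (r • T') := fun r hr =>
    hT'.const_smul_of_ne_zero hr.ne'
  have hvE : ∀ r : ℝ, 0 < r → volume (r • T') = ENNReal.ofReal (r ^ d) * volume T := by
    intro r hr
    rw [Measure.addHaar_smul, finrank_euclideanSpace_fin, abs_of_pos (pow_pos hr d),
      measure_congr hTT']
  have hEfin : ∀ r : ℝ, 0 < r → volume (r • T') ≠ ⊤ := by
    intro r hr
    rw [hvE r hr]
    exact ENNReal.mul_ne_top ENNReal.ofReal_ne_top hTfin.ne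
  set J : ℝ → ℝ≥0∞ := fun r => ∫⁻ u, ‖bandKernel (freqSet Ω') u‖ₑ ^ 2 *
    volume (T' ∩ {x | x + r⁻¹ • u ∉ T'}) with hJ
  have hJfin : ∀ r, J r ≠ ⊤ := by
    intro r
    have hK : Measurable fun u => ‖bandKernel (freqSet Ω') u‖ₑ ^ 2 :=
      (continuous_bandKernel hW hWfin).measurable.enorm.pow_const 2
    refine ne_top_of_le_ne_top (ENNReal.mul_ne_top hWfin hT'fin) ?_
    rw [← lintegral_bandKernel_sq hW hWfin, ← lintegral_mul_const _ hK]
    refine lintegral_mono fun u => ?_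
    gcongr
    exact Set.inter_subset_left
  refine ⟨fun r hr ι b => ?_, fun r => (J r).toReal, fun r => ENNReal.toReal_nonneg, ?_, ?_⟩
  · rw [hop r hr]
    exact hsNormSq_limitingOp_ne_top (hE r hr) (hEfin r hr) hW hWfin b
  · have h := (ENNReal.tendsto_toReal ENNReal.zero_ne_top).comp
      (tendsto_lintegral_bandKernel hT' hT'fin hW hWfin)
    exact h
  · intro r σ hr hσ0 hσ1
    obtain ⟨n, hn, hle⟩ := exists_data hd (hE r hr) (hEfin r hr) hW hWfin hσ0 hσ1
    refine ⟨n, fun m hm => hop r hr ▸ hn m hm, ?_⟩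
    rw [hvE r hr, hvW, leakage_smul hr] at hle
    have hfin : ENNReal.ofReal σ * (n : ℝ≥0∞) ≠ ⊤ :=
      ENNReal.mul_ne_top ENNReal.ofReal_ne_top (ENNReal.natCast_ne_top n)
    have hfin2 : ENNReal.ofReal (r ^ d) * J r ≠ ⊤ :=
      ENNReal.mul_ne_top ENNReal.ofReal_ne_top (hJfin r)
    have h := ENNReal.toReal_mono (ENNReal.add_ne_top.2 ⟨hfin, hfin2⟩) hle
    rw [ENNReal.toReal_add hfin hfin2] at h
    simp only [ENNReal.toReal_mul, ENNReal.toReal_ofReal hσ0.le,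
      ENNReal.toReal_ofReal (pow_pos hr d).le, ENNReal.toReal_ofReal (pow_pos hpi d).le,
      ENNReal.toReal_natCast] at h
    rw [inv_pow] at h
    change σ * (((2 * Real.pi) ^ d)⁻¹ * volume.real Ω * (r ^ d * volume.real T)) ≤
      σ * n + r ^ d * (J r).toReal at h
    have h2 : (((2 * Real.pi) ^ d)⁻¹ * volume.real T * volume.real Ω - (J r).toReal / σ) * r ^ d =
        (σ * (((2 * Real.pi) ^ d)⁻¹ * volume.real Ω * (r ^ d * volume.real T)) -
          r ^ d * (J r).toReal) / σ := by
      field_simp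
    rw [h2, div_le_iff₀ hσ0]
    linarith

end Existence

/-! ### Counting pseudo prolate functions -/

theorem kernelShare_nonneg {ε σ : ℝ} (hσ : σ ^ 2 ≤ ε) (hε : ε < 1) : 0 ≤ kernelShare ε σ :=
  div_nonneg (by linarith) (by linarith)

theorem one_sub_kernelShare {ε σ : ℝ} (hσ : σ ^ 2 ≤ ε) (hε : ε < 1) :
    1 - kernelShare ε σ = (1 - ε) / (1 - σ ^ 2) := by
  have h : 1 - σ ^ 2 ≠ 0 := by linarith
  rw [kernelShare]
  field_simp
  ring

theorem kernelShare_lt_one {ε σ : ℝ} (hσ : σ ^ 2 ≤ ε) (hε : ε < 1) : kernelShare ε σ < 1 := by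
  have h := one_sub_kernelShare hσ hε
  have h2 : 0 < (1 - ε) / (1 - σ ^ 2) := div_pos (by linarith) (by linarith)
  linarith

/-- The choice of `m` makes the share `m / (m + n)` of kernel vectors as large as the bound on
`‖P Φ_j - Φ_j‖²` permits, up to rounding. -/
theorem share_bounds {n : ℕ} {κ : ℝ} (hκ0 : 0 ≤ κ) (hκ1 : κ < 1) :
    ((⌊n * κ / (1 - κ)⌋₊ : ℝ) / (⌊n * κ / (1 - κ)⌋₊ + n) ≤ κ) ∧
      (1 - κ)⁻¹ * n - 1 ≤ (⌊n * κ / (1 - κ)⌋₊ : ℝ) + n := by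
  have h1 : 0 < 1 - κ := by linarith
  have h0 : 0 ≤ n * κ / (1 - κ) := by positivity
  have hle := Nat.floor_le h0
  have hlt := Nat.lt_floor_add_one (n * κ / (1 - κ))
  constructor
  · refine div_le_of_le_mul₀ (by positivity) hκ0 ?_
    rw [le_div_iff₀ h1] at hle
    nlinarith
  · have h2 : (1 - κ)⁻¹ * n = n * κ / (1 - κ) + n := by
      field_simp
      ring
    linarith

theorem lt_one_of_sq_le {ε σ : ℝ} (hσ : σ ^ 2 ≤ ε) (hε : ε < 1) : σ < 1 := by
  nlinarith

/-- The construction with a given `σ` and the optimal `m`. -/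
theorem exists_data_kernelShare {H : Type*} [NormedAddCommGroup H] [InnerProductSpace ℂ H]
    {P : H →L[ℂ] H} (hP : P.IsSymmetric) (hP1 : ‖P‖ ≤ 1) {ε σ : ℝ} (hσ : σ ^ 2 ≤ ε)
    (hε : ε < 1) {n : ℕ} (hn : ∀ m : ℕ, (0 < n ∨ m = 0) → Nonempty (Data P σ n m)) :
    ∃ (m : ℕ) (S : Data P σ n m),
      m = ⌊n * kernelShare ε σ / (1 - kernelShare ε σ)⌋₊ ∧
      (∀ j, ‖P (S.pseudoProlate j) - S.pseudoProlate j‖ ^ 2 ≤ ε) ∧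
      (1 - kernelShare ε σ)⁻¹ * n - 1 ≤ (m : ℝ) + n := by
  have hσ1 := lt_one_of_sq_le hσ hε
  have hb := share_bounds (n := n) (kernelShare_nonneg hσ hε) (kernelShare_lt_one hσ hε)
  obtain ⟨S⟩ := hn ⌊n * kernelShare ε σ / (1 - kernelShare ε σ)⌋₊ (by
    rcases Nat.eq_zero_or_pos n with h | h
    · right; simp [h]
    · exact Or.inl h)
  refine ⟨_, S, rfl, fun j => ?_, hb.2⟩
  refine (S.norm_sub_sq_le hP hP1 hσ1 j).trans ?_
  have h1 : 0 < 1 - σ ^ 2 := by linarith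
  calc _ ≤ σ ^ 2 + (1 - σ ^ 2) * kernelShare ε σ := by
        gcongr
        exact hb.1
    _ = ε := by
        rw [kernelShare]
        field_simp
        ring

theorem isLittleO_pow_mul {d : ℕ} {q : ℝ → ℝ} (hq : Tendsto q atTop (𝓝 0)) :
    (fun r : ℝ => q r * r ^ d) =o[atTop] fun r : ℝ => r ^ d := by
  have h := ((isLittleO_one_iff ℝ).2 hq).mul_isBigO (isBigO_refl (fun r : ℝ => r ^ d) atTop)
  simpa using h

theorem isLittleO_const_pow {d : ℕ} (hd : 0 < d) (c : ℝ) :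
    (fun _ : ℝ => c) =o[atTop] fun r : ℝ => r ^ d :=
  isLittleO_const_left.2 (Or.inr (tendsto_norm_atTop_atTop.comp (tendsto_pow_atTop hd.ne')))

theorem maxCount_lt_top {d : ℕ} {T Ω : Set (EuclideanSpace ℝ (Fin d))} {ι : Type*}
    (b : HilbertBasis ι ℂ (L2 d)) (h : hsNormSq b (limitingOp T Ω) ≠ ⊤) {ε : ℝ} (hε : ε < 1) :
    maxCount ε T Ω < ⊤ := by
  have hsq : 0 < 1 - Real.sqrt ε := by
    rw [sub_pos, Real.sqrt_lt' one_pos]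
    simpa using hε
  set δ := ENNReal.ofReal ((1 - Real.sqrt ε) ^ 2) with hδ
  have hδ0 : δ ≠ 0 := by
    rw [hδ, ne_eq, ENNReal.ofReal_eq_zero, not_le]
    positivity
  obtain ⟨K, hK⟩ := ENNReal.exists_nat_gt (ENNReal.div_ne_top h hδ0)
  refine lt_of_le_of_lt (sSup_le ?_) (ENat.natCast_lt_top K)
  rintro _ ⟨N, rfl, Φ, hΦ, hle⟩
  have h1 := card_mul_le_hsNormSq b (limitingOp T Ω) hε hΦ hle
  have h2 : (N : ℝ≥0∞) ≤ hsNormSq b (limitingOp T Ω) / δ := by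
    rw [ENNReal.le_div_iff_mul_le (Or.inl hδ0) (Or.inl ENNReal.ofReal_ne_top)]
    exact h1
  have h3 : (N : ℝ≥0∞) < K := h2.trans_lt hK
  exact_mod_cast h3.le

theorem le_maxCount {d : ℕ} {T Ω : Set (EuclideanSpace ℝ (Fin d))} {ε : ℝ} {N : ℕ}
    {Φ : Fin N → L2 d} (hΦ : Orthonormal ℂ Φ)
    (h : ∀ j, ‖limitingOp T Ω (Φ j) - Φ j‖ ^ 2 ≤ ε) : (N : ℕ∞) ≤ maxCount ε T Ω :=
  le_sSup ⟨N, rfl, Φ, hΦ, h⟩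

/-- A choice of `σ` for which both `σ` and `L / σ` tend to zero. The summand `r⁻¹` keeps it positive
where `L` vanishes, and the minimum ensures `σ² ≤ ε` for all `r`. -/
def slowSigma (ε : ℝ) (L : ℝ → ℝ) (r : ℝ) : ℝ := min (Real.sqrt ε) (Real.sqrt (L r) + r⁻¹)

section SlowSigma

variable {ε : ℝ} {L : ℝ → ℝ}

theorem slowSigma_pos (hε : 0 < ε) {r : ℝ} (hr : 0 < r) : 0 < slowSigma ε L r :=
  lt_min (Real.sqrt_pos.2 hε) (by positivity)

theorem slowSigma_sq_le (hε : 0 < ε) {r : ℝ} (hr : 0 < r) : slowSigma ε L r ^ 2 ≤ ε := by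
  calc slowSigma ε L r ^ 2 ≤ Real.sqrt ε ^ 2 :=
        pow_le_pow_left₀ (slowSigma_pos hε hr).le (min_le_left _ _) 2
    _ = ε := Real.sq_sqrt hε.le

theorem tendsto_slowSigma (hL : Tendsto L atTop (𝓝 0)) :
    Tendsto (slowSigma ε L) atTop (𝓝 0) := by
  have h := (tendsto_const_nhds (x := Real.sqrt ε)).min (hL.sqrt.add tendsto_inv_atTop_zero)
  change Tendsto (fun r => min (Real.sqrt ε) (Real.sqrt (L r) + r⁻¹)) _ _
  simpa using h

theorem tendsto_div_slowSigma (hε : 0 < ε) (hL0 : ∀ r, 0 ≤ L r) (hL : Tendsto L atTop (𝓝 0)) :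
    Tendsto (fun r => L r / slowSigma ε L r) atTop (𝓝 0) := by
  have h : Tendsto (fun r => L r / Real.sqrt ε + Real.sqrt (L r)) atTop (𝓝 0) := by
    have h := (hL.div_const (Real.sqrt ε)).add hL.sqrt
    simpa using h
  have hs : 0 < Real.sqrt ε := Real.sqrt_pos.2 hε
  refine tendsto_of_tendsto_of_tendsto_of_le_of_le' tendsto_const_nhds h ?_ ?_
  · filter_upwards [eventually_gt_atTop 0] with r hr
    exact div_nonneg (hL0 r) (slowSigma_pos hε hr).le
  · filter_upwards [eventually_gt_atTop 0] with r hr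
    have h0 : 0 ≤ L r / Real.sqrt ε := div_nonneg (hL0 r) hs.le
    have h1 : L r / (Real.sqrt (L r) + r⁻¹) ≤ Real.sqrt (L r) := by
      refine div_le_of_le_mul₀ (by positivity) (Real.sqrt_nonneg _) ?_
      have h2 := Real.mul_self_sqrt (hL0 r)
      have h3 : 0 ≤ Real.sqrt (L r) * r⁻¹ := by positivity
      linarith [mul_add (Real.sqrt (L r)) (Real.sqrt (L r)) r⁻¹]
    rw [slowSigma]
    rcases min_choice (Real.sqrt ε) (Real.sqrt (L r) + r⁻¹) with h' | h' <;> rw [h']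
    · linarith [Real.sqrt_nonneg (L r)]
    · linarith

end SlowSigma

end PseudoProlate

end
theorem mainTheorem1 (d : ℕ) (hd : 0 < d) (T Ω : Set (EuclideanSpace ℝ (Fin d)))
    (hT : NullMeasurableSet T volume) (hΩ : NullMeasurableSet Ω volume)
    (hTfin : volume T < ⊤) (hΩfin : volume Ω < ⊤) (ε : ℝ) (hε₀ : 0 < ε) (hε₁ : ε < 1) :
    -- the real form of the DFT matrix is orthogonal
    (∀ N : ℕ, (PseudoProlate.realDFT N)ᵀ * PseudoProlate.realDFT N = 1) ∧
    -- the construction can be carried out: `n` is the number of eigenvalues above `1 - σ`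
    (∀ r σ : ℝ, 0 < r → 0 < σ → σ ^ 2 ≤ ε → ∃ n : ℕ, ∀ m : ℕ, (0 < n ∨ m = 0) →
      Nonempty (PseudoProlate.Data (PseudoProlate.limitingOp (r • T) Ω) σ n m)) ∧
    -- the functions it yields
    (∀ r σ : ℝ, 0 < r → 0 < σ → σ ^ 2 ≤ ε → ∀ (n m : ℕ)
      (S : PseudoProlate.Data (PseudoProlate.limitingOp (r • T) Ω) σ n m),
      Orthonormal ℂ S.pseudoProlate ∧
      Submodule.span ℂ (Set.range S.pseudoProlate) =
        Submodule.span ℂ (Set.range S.φ) ⊔ Submodule.span ℂ (Set.range S.h) ∧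
      ∀ j, PseudoProlate.limitingOp (r • T) Ω (S.kernelPart j) = 0 ∧
        (∀ g, PseudoProlate.limitingOp (r • T) Ω g = 0 → inner ℂ g (S.eigenPart j) = 0) ∧
        ‖S.kernelPart j‖ ^ 2 = (m : ℝ) / (m + n) ∧
        ‖PseudoProlate.limitingOp (r • T) Ω (S.pseudoProlate j) - S.pseudoProlate j‖ ^ 2
          ≤ σ ^ 2 + (1 - σ ^ 2) * ((m : ℝ) / (m + n))) ∧
    -- their number for a fixed `σ`
    (∀ σ : ℝ, 0 < σ → σ ^ 2 ≤ ε → ∃ g : ℝ → ℝ, g =o[atTop] (fun r : ℝ => r ^ d) ∧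
      ∀ r : ℝ, 0 < r → ∃ (n m : ℕ)
        (S : PseudoProlate.Data (PseudoProlate.limitingOp (r • T) Ω) σ n m),
        m = ⌊n * PseudoProlate.kernelShare ε σ / (1 - PseudoProlate.kernelShare ε σ)⌋₊ ∧
        (∀ j, ‖PseudoProlate.limitingOp (r • T) Ω (S.pseudoProlate j)
          - S.pseudoProlate j‖ ^ 2 ≤ ε) ∧
        (1 - PseudoProlate.kernelShare ε σ)⁻¹ * ((2 * Real.pi) ^ d)⁻¹
            * volume.real T * volume.real Ω * r ^ d + g r ≤ (m : ℝ) + n) ∧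
    -- their number when `σ` may depend on `r`
    (∃ g : ℝ → ℝ, g =o[atTop] (fun r : ℝ => r ^ d) ∧
      ∀ r : ℝ, 0 < r → ∃ (σ : ℝ) (n m : ℕ)
        (S : PseudoProlate.Data (PseudoProlate.limitingOp (r • T) Ω) σ n m),
        0 < σ ∧ σ ^ 2 ≤ ε ∧ Orthonormal ℂ S.pseudoProlate ∧
        (∀ j, ‖PseudoProlate.limitingOp (r • T) Ω (S.pseudoProlate j)
          - S.pseudoProlate j‖ ^ 2 ≤ ε) ∧
        (1 - ε)⁻¹ * ((2 * Real.pi) ^ d)⁻¹ * volume.real T * volume.real Ω * r ^ d + g r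
          ≤ (m : ℝ) + n) ∧
    -- the maximal count
    (∀ r : ℝ, 0 < r → PseudoProlate.maxCount ε (r • T) Ω < ⊤) ∧
    ENNReal.ofReal ((1 - ε)⁻¹ * ((2 * Real.pi) ^ d)⁻¹ * volume.real T * volume.real Ω) ≤
      liminf (fun r : ℝ => (PseudoProlate.maxCount ε (r • T) Ω : ℝ≥0∞) / ENNReal.ofReal (r ^ d))
        atTop := by
  have hfacts := PseudoProlate.exists_data_smul hd hT hΩ hTfin hΩfin
  obtain ⟨hHS, L, hL0, hL, hdata⟩ := hfacts
  have hsym : ∀ r : ℝ, (PseudoProlate.limitingOp (r • T) Ω).IsSymmetric := fun r =>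
    PseudoProlate.isSymmetric_limitingOp _ _
  have hnorm : ∀ r : ℝ, ‖PseudoProlate.limitingOp (r • T) Ω‖ ≤ 1 := fun r =>
    PseudoProlate.norm_limitingOp_le _ _
  set M : ℝ := ((2 * Real.pi) ^ d)⁻¹ * volume.real T * volume.real Ω with hM
  -- The optimal `m` for a given `σ`, with the number of functions bounded from below.
  have hcount : ∀ r σ : ℝ, 0 < r → 0 < σ → σ ^ 2 ≤ ε → ∃ (n m : ℕ)
      (S : PseudoProlate.Data (PseudoProlate.limitingOp (r • T) Ω) σ n m),
      m = ⌊n * PseudoProlate.kernelShare ε σ / (1 - PseudoProlate.kernelShare ε σ)⌋₊ ∧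
      (∀ j, ‖PseudoProlate.limitingOp (r • T) Ω (S.pseudoProlate j)
        - S.pseudoProlate j‖ ^ 2 ≤ ε) ∧
      (1 - PseudoProlate.kernelShare ε σ)⁻¹ * ((M - L r / σ) * r ^ d) - 1 ≤ (m : ℝ) + n := by
    intro r σ hr hσ0 hσ
    obtain ⟨n, hn, hle⟩ := hdata r σ hr hσ0 (PseudoProlate.lt_one_of_sq_le hσ hε₁)
    obtain ⟨m, S, hm, hS, hmn⟩ := PseudoProlate.exists_data_kernelShare (hsym r) (hnorm r) hσ hε₁ hn
    refine ⟨n, m, S, hm, hS, le_trans ?_ hmn⟩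
    have hκ := PseudoProlate.kernelShare_lt_one hσ hε₁
    have hκ' : 0 ≤ (1 - PseudoProlate.kernelShare ε σ)⁻¹ := inv_nonneg.2 (by linarith)
    linarith [mul_le_mul_of_nonneg_left hle hκ']
  have hvar : ∃ g : ℝ → ℝ, g =o[atTop] (fun r : ℝ => r ^ d) ∧
      ∀ r : ℝ, 0 < r → ∃ (σ : ℝ) (n m : ℕ)
        (S : PseudoProlate.Data (PseudoProlate.limitingOp (r • T) Ω) σ n m),
        0 < σ ∧ σ ^ 2 ≤ ε ∧ Orthonormal ℂ S.pseudoProlate ∧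
        (∀ j, ‖PseudoProlate.limitingOp (r • T) Ω (S.pseudoProlate j)
          - S.pseudoProlate j‖ ^ 2 ≤ ε) ∧
        (1 - ε)⁻¹ * ((2 * Real.pi) ^ d)⁻¹ * volume.real T * volume.real Ω * r ^ d + g r
          ≤ (m : ℝ) + n := by
    let σ : ℝ → ℝ := PseudoProlate.slowSigma ε L
    -- `1 / (1 - γ(σ)) = (1 - σ²) / (1 - ε)`, so `q r` is the coefficient of `r ^ d` in the error.
    let q : ℝ → ℝ := fun r => (1 - ε)⁻¹ * ((1 - σ r ^ 2) * (M - L r / σ r) - M)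
    have hq : Tendsto q atTop (𝓝 0) := by
      have h1 := (PseudoProlate.tendsto_slowSigma (ε := ε) hL).pow 2
      have h2 := PseudoProlate.tendsto_div_slowSigma hε₀ hL0 hL
      have h3 := ((((tendsto_const_nhds (x := (1 : ℝ))).sub h1).mul
        ((tendsto_const_nhds (x := M)).sub h2)).sub_const M).const_mul (1 - ε)⁻¹
      simpa using h3
    refine ⟨fun r => q r * r ^ d - 1, (PseudoProlate.isLittleO_pow_mul hq).sub
      (PseudoProlate.isLittleO_const_pow hd 1), fun r hr => ?_⟩
    have hσ0 : 0 < σ r := PseudoProlate.slowSigma_pos hε₀ hr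
    have hσ : σ r ^ 2 ≤ ε := PseudoProlate.slowSigma_sq_le hε₀ hr
    obtain ⟨n, m, S, -, hS, hmn⟩ := hcount r (σ r) hr hσ0 hσ
    refine ⟨σ r, n, m, S, hσ0, hσ, S.orthonormal_pseudoProlate (hsym r)
      (PseudoProlate.lt_one_of_sq_le hσ hε₁), hS, le_trans (le_of_eq ?_) hmn⟩
    rw [PseudoProlate.one_sub_kernelShare hσ hε₁, inv_div, div_eq_mul_inv]
    simp only [q, hM]
    ring
  refine ⟨PseudoProlate.realDFT_transpose_mul, ?_, ?_, ?_, hvar, ?_, ?_⟩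
  · intro r σ hr hσ0 hσ
    obtain ⟨n, hn, -⟩ := hdata r σ hr hσ0 (PseudoProlate.lt_one_of_sq_le hσ hε₁)
    exact ⟨n, hn⟩
  · intro r σ hr hσ0 hσ n m S
    have hσ1 := PseudoProlate.lt_one_of_sq_le hσ hε₁
    exact ⟨S.orthonormal_pseudoProlate (hsym r) hσ1, S.span_pseudoProlate, fun j =>
      ⟨S.apply_kernelPart j, fun g hg => S.inner_eigenPart_of_mem_ker (hsym r) hσ1 j hg,
        S.norm_kernelPart_sq j, S.norm_sub_sq_le (hsym r) (hnorm r) hσ1 j⟩⟩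
  · intro σ hσ0 hσ
    have hq : Tendsto (fun r => -((1 - PseudoProlate.kernelShare ε σ)⁻¹ * (L r / σ)))
        atTop (𝓝 0) := by
      have h := ((hL.div_const σ).const_mul (1 - PseudoProlate.kernelShare ε σ)⁻¹).neg
      simpa using h
    refine ⟨_, (PseudoProlate.isLittleO_pow_mul hq).sub
      (PseudoProlate.isLittleO_const_pow hd 1), fun r hr => ?_⟩
    obtain ⟨n, m, S, hm, hS, hmn⟩ := hcount r σ hr hσ0 hσ
    refine ⟨n, m, S, hm, hS, le_trans (le_of_eq ?_) hmn⟩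
    simp only [hM]
    ring
  · intro r hr
    obtain ⟨_, b, _⟩ := exists_hilbertBasis ℂ (PseudoProlate.L2 d)
    exact PseudoProlate.maxCount_lt_top b (hHS r hr b) hε₁
  · obtain ⟨g, hg, hex⟩ := hvar
    set C : ℝ := (1 - ε)⁻¹ * ((2 * Real.pi) ^ d)⁻¹ * volume.real T * volume.real Ω with hC
    have hlim : Tendsto (fun r : ℝ => ENNReal.ofReal (C + g r / r ^ d)) atTop
        (𝓝 (ENNReal.ofReal C)) := by
      have h := (tendsto_const_nhds (x := C)).add hg.tendsto_div_nhds_zero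
      rw [add_zero] at h
      exact (ENNReal.continuous_ofReal.tendsto C).comp h
    rw [← hlim.liminf_eq]
    refine liminf_le_liminf ?_
    filter_upwards [eventually_gt_atTop 0] with r hr
    obtain ⟨σ, n, m, S, -, -, hon, hS, hmn⟩ := hex r hr
    have hrd : 0 < r ^ d := pow_pos hr d
    have h1 : C + g r / r ^ d ≤ ((m + n : ℕ) : ℝ) / r ^ d := by
      rw [le_div_iff₀ hrd, add_mul, div_mul_cancel₀ _ hrd.ne']
      push_cast
      exact hmn
    have h2 : ((m + n : ℕ) : ℝ≥0∞) ≤ (PseudoProlate.maxCount ε (r • T) Ω : ℝ≥0∞) := by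
      exact_mod_cast PseudoProlate.le_maxCount hon hS
    calc ENNReal.ofReal (C + g r / r ^ d)
        ≤ ENNReal.ofReal (((m + n : ℕ) : ℝ) / r ^ d) := ENNReal.ofReal_le_ofReal h1
      _ = ((m + n : ℕ) : ℝ≥0∞) / ENNReal.ofReal (r ^ d) := by
          rw [ENNReal.ofReal_div_of_pos hrd, ENNReal.ofReal_natCast]
      _ ≤ _ := ENNReal.div_le_div_right h2 _
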